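/- Let $\Theta\subset\mathbb R^q$ be compact, let $k\ge1$ be an integer and let $\mathcal Z=[a,b]$, $a<b$. Let $\mathcal H_k$ be the Sobolev class of functions $\eta:\mathcal Z\to\mathbb R$ such that $\eta^{(k-1)}$ exists and is absolutely continuous and $J(\eta)<\infty$, where $J^2(\eta)=\int_{\mathcal Z}(\eta^{(k)}(z))^2\,dz$. Let $\{p_{\theta,\eta}:\theta\in\Theta,\eta\in\mathcal H_k\}$ be strictly positive probability densities with respect to a measure $\nu$, and put $\ell_{\theta,\eta}=\log p_{\theta,\eta}$. Let $\theta_0\in\Theta$, $\eta_0\in\mathcal H_k$ be the true values, $\ell_0=\ell_{\theta_0,\eta_0}$, let $P$ be the distribution with density $p_{\theta_0,\eta_0}$, write $Pf=\int f\,dP$, $\|f\|_2=(Pf^2)^{1/2}$, and let $\mathbb P_n$ be the empirical distribution of independent observations $X_1,\dots,X_n$ with distribution $P$. Let $\lambda_n>0$ be smoothing parameters, possibly depending on the data, with $\lambda_n=o_P(n^{-1/4})$ and $\lambda_n^{-1}=O_P(n^{k/(2k+1)})$. For fixed $\theta$, let $\hat\eta_{\theta,\lambda_n}$ denote a maximizer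 over $\eta\in\mathcal H_k$ of the penalized log-likelihood $\mathbb P_n\ell_{\theta,\eta}-\lambda_n^2J^2(\eta)$. Let $C_1>0$ be a constant and, for each $n$, let $\Theta_n\subset\{\theta\in\Theta:\|\theta-\theta_0\|\le C_1\}$ and $\mathcal V_n\subset\{\eta\in\mathcal H_k:\|\eta-\eta_0\|_\infty\le C_1\}$ with $\eta_0\in\mathcal V_n$. For each $\theta$ let $d_\theta(\cdot,\cdot)\ge0$ be a nonnegative real-valued function (a distance measure). Define $$\mathcal K=\Big\{\frac{\ell_{\theta,\eta}-\ell_0}{1+J(\eta)}:\ \theta\in\Theta,\ \|\theta-\theta_0\|\le C_1,\ \eta\in\mathcal H_k,\ \|\eta-\eta_0\|_\infty\le C_1\Big\}.$$ Let $H_B(\epsilon,\mathcal K,L_2(P))=\log N_B(\epsilon,\mathcal K,L_2(P))$, where $N_B$ is the least number of brackets $[l,u]$ with $l,u\in L_2(P)$ and $\|u-l\|_2\le\epsilon$ such that every $f\in\mathcal K$ satisfies $l\le f\le u$ pointwise for one of them. Assume that there are constants $c>0$ and $C<\infty$ such that: 1. $H_B(\epsilon,\mathcal K,L_2(P))\le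 C\epsilon^{-1/k}$ for all $\epsilon>0$; and, for all $n$, all $\theta\in\Theta_n$ and all $\eta\in\mathcal V_n$, 2. $c\le p_{\theta,\eta}(x)/p_{\theta,\eta_0}(x)\le C$ for all $x$; 3. $\|\ell_{\theta,\eta}-\ell_0\|_2\le C\,(\|\theta-\theta_0\|+d_\theta(\eta,\eta_0))$; 4. $P(\ell_{\theta,\eta}-\ell_{\theta,\eta_0})\le -c\,d_\theta^2(\eta,\eta_0)+C\|\theta-\theta_0\|^2$. Let $\tilde\theta_n$ be random and suppose that, with probability tending to one, the maximizer $\hat\eta_{\tilde\theta_n,\lambda_n}$ exists, and that $P(\tilde\theta_n\in\Theta_n,\ \hat\eta_{\tilde\theta_n,\lambda_n}\in\mathcal V_n)\to1$. Then $$d_{\tilde\theta_n}(\hat\eta_{\tilde\theta_n,\lambda_n},\eta_0)=O_P(\lambda_n+\|\tilde\theta_n-\theta_0\|)\quad\text{and}\quad \lambda_nJ(\hat\eta_{\tilde\theta_n,\lambda_n})=O_P(\lambda_n+\|\tilde\theta_n-\theta_0\|).$$ -/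

import Mathlib

open MeasureTheory ProbabilityTheory Filter Topology Set
open scoped ENNReal

noncomputable section

namespace PenalizedRate

/-! ### The Sobolev class and the roughness penalty -/

/-- The function on the line that agrees with `η` on `[a, b]` and vanishes elsewhere. It is only
ever differentiated within `[a, b]`, so the values outside do not matter. -/
def extendZero {a b : ℝ} (η : Icc a b → ℝ) (z : ℝ) : ℝ :=
  open Classical in if h : z ∈ Icc a b then η ⟨z, h⟩ else 0

/-- The `j`-th derivative of a function on `[a, b]` (one-sided at the end points). -/
def derivOn {a b : ℝ} (j : ℕ) (η : Icc a b → ℝ) : ℝ → ℝ :=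
  iteratedDerivWithin j (extendZero η) (Icc a b)

/-- The roughness `J(η)`, with `J(η)² = ∫_a^b (η⁽ᵏ⁾(z))² dz`. -/
def roughness {a b : ℝ} (k : ℕ) (η : Icc a b → ℝ) : ℝ :=
  Real.sqrt (∫ z in Icc a b, (derivOn k η z) ^ 2)

/-- The Sobolev class of degree `k ≥ 1` on `[a, b]`: `η` is `k - 1` times continuously
differentiable, its `(k-1)`-st derivative is absolutely continuous (so that the `k`-th derivative
exists almost everywhere), and `J(η) < ∞`. -/
def sobolevClass (k : ℕ) (a b : ℝ) : Set (Icc a b → ℝ) :=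
  {η | ContDiffOn ℝ ((k - 1 : ℕ) : WithTop ℕ∞) (extendZero η) (Icc a b) ∧
    AbsolutelyContinuousOnInterval (derivOn (k - 1) η) a b ∧
    IntegrableOn (fun z => (derivOn k η z) ^ 2) (Icc a b)}

/-! ### Bracketing numbers in `L₂(P)` -/

section Bracketing

variable {𝓧 : Type*} [MeasurableSpace 𝓧]

/-- The class `𝓐` is covered by `N` brackets `[l j, u j]` with end points in `L₂(P)` and with
`‖u j - l j‖₂ ≤ δ`. -/
def CoveredByBrackets (P : Measure 𝓧) (𝓐 : Set (𝓧 → ℝ)) (δ : ℝ) (N : ℕ) : Prop :=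
  ∃ l u : Fin N → 𝓧 → ℝ,
    (∀ j, MemLp (l j) 2 P ∧ MemLp (u j) 2 P ∧
      eLpNorm (fun x => u j x - l j x) 2 P ≤ ENNReal.ofReal δ) ∧
    ∀ f ∈ 𝓐, ∃ j, ∀ x, l j x ≤ f x ∧ f x ≤ u j x

/-- The `δ`-bracketing number `N_B(δ, 𝓐, L₂(P))`, infinite if no finite number suffices. -/
def bracketingNumber (P : Measure 𝓧) (𝓐 : Set (𝓧 → ℝ)) (δ : ℝ) : ℕ∞ :=
  ⨅ (N : ℕ) (_ : CoveredByBrackets P 𝓐 δ N), (N : ℕ∞)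

/-- The `δ`-bracketing entropy `H_B(δ, 𝓐, L₂(P)) = log N_B(δ, 𝓐, L₂(P))`. -/
def bracketingEntropy (P : Measure 𝓧) (𝓐 : Set (𝓧 → ℝ)) (δ : ℝ) : EReal :=
  ENNReal.log ((bracketingNumber P 𝓐 δ : ℕ∞) : ℝ≥0∞)

end Bracketing

/-! ### Stochastic orders

For sets that are not measurable, `μ` is the outer measure. -/

section Orders

variable {Ω : Type*} [MeasurableSpace Ω]

/-- `Y n = O_P(Z n)`. -/
def IsBigOP (μ : Measure Ω) (Y Z : ℕ → Ω → ℝ) : Prop :=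
  ∀ ε : ℝ, 0 < ε → ∃ M : ℝ, ∀ᶠ n in atTop,
    μ {ω | M * |Z n ω| < |Y n ω|} ≤ ENNReal.ofReal ε

/-- `Y n = o_P(Z n)`. -/
def IsLittleOP (μ : Measure Ω) (Y Z : ℕ → Ω → ℝ) : Prop :=
  ∀ δ : ℝ, 0 < δ → Tendsto (fun n => μ {ω | δ * |Z n ω| < |Y n ω|}) atTop (𝓝 0)

/-- The events `A n` have probability tending to one, stated as: their complements have (outer)
probability tending to zero. -/
def WithProbTendstoOne (μ : Measure Ω) (A : ℕ → Set Ω) : Prop :=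
  Tendsto (fun n => μ (A n)ᶜ) atTop (𝓝 0)

end Orders

/-! ### The semiparametric model and the penalized log-likelihood -/

section Model

variable {𝓧 E : Type*} [MeasurableSpace 𝓧] {a b : ℝ}

/-- `p θ η`, for `θ ∈ Θ` and `η ∈ H`, are (strictly positive) probability densities with respect
to the dominating measure `ν`. -/
structure IsDensityFamily (ν : Measure 𝓧) (Θ : Set E) (H : Set (Icc a b → ℝ))
    (p : E → (Icc a b → ℝ) → 𝓧 → ℝ) : Prop where
  measurable : ∀ θ ∈ Θ, ∀ η ∈ H, Measurable (p θ η)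
  pos : ∀ θ ∈ Θ, ∀ η ∈ H, ∀ x, 0 < p θ η x
  total : ∀ θ ∈ Θ, ∀ η ∈ H, ∫⁻ x, ENNReal.ofReal (p θ η x) ∂ν = 1

/-- The distribution with density `f` with respect to `ν`. -/
def densityLaw (ν : Measure 𝓧) (f : 𝓧 → ℝ) : Measure 𝓧 :=
  ν.withDensity (fun x => ENNReal.ofReal (f x))

/-- The log-likelihood `ℓ_{θ,η}(x)` of a single observation. -/
def loglik (p : E → (Icc a b → ℝ) → 𝓧 → ℝ) (θ : E) (η : Icc a b → ℝ) (x : 𝓧) : ℝ :=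
  Real.log (p θ η x)

/-- The penalized log-likelihood `ℙ_n ℓ_{θ,η} - λ² J²(η)` of the observations
`x 0, …, x (n - 1)`. -/
def penLoglik (k : ℕ) (p : E → (Icc a b → ℝ) → 𝓧 → ℝ) (n : ℕ) (x : ℕ → 𝓧) (lam : ℝ)
    (θ : E) (η : Icc a b → ℝ) : ℝ :=
  (∑ i ∈ Finset.range n, loglik p θ η (x i)) / n - lam ^ 2 * roughness k η ^ 2

/-- `η` is a penalized maximum likelihood estimator of the nuisance parameter for fixed `θ`: it
maximizes the penalized log-likelihood over the Sobolev class of degree `k`. -/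
def IsPenalizedMLE (k : ℕ) (p : E → (Icc a b → ℝ) → 𝓧 → ℝ) (n : ℕ) (x : ℕ → 𝓧) (lam : ℝ)
    (θ : E) (η : Icc a b → ℝ) : Prop :=
  η ∈ sobolevClass k a b ∧
    ∀ η' ∈ sobolevClass k a b, penLoglik k p n x lam θ η' ≤ penLoglik k p n x lam θ η

/-- The class `𝓚` of normalized log-likelihood ratios `(ℓ_{θ,η} - ℓ₀) / (1 + J(η))` with
`θ ∈ Θ`, `‖θ - θ₀‖ ≤ C`, `‖η - η₀‖_∞ ≤ C` and `η` in the Sobolev class. -/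
def normalizedClass [NormedAddCommGroup E] (k : ℕ) (p : E → (Icc a b → ℝ) → 𝓧 → ℝ) (Θ : Set E)
    (θ₀ : E) (η₀ : Icc a b → ℝ) (C : ℝ) : Set (𝓧 → ℝ) :=
  {f | ∃ θ ∈ Θ, ∃ η ∈ sobolevClass k a b, ‖θ - θ₀‖ ≤ C ∧ (∀ z, |η z - η₀ z| ≤ C) ∧
    f = fun x => (loglik p θ η x - loglik p θ₀ η₀ x) / (1 + roughness k η)}

end Model

end PenalizedRate

end

/-! Write `D = ℓ_{θ,η} - ℓ_{θ,η₀}` at the estimator `η` and the random `θ`, with `τ = ‖θ - θ₀‖`, `d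
= d_θ(η, η₀)`, `J = J(η)`, `J₀ = J(η₀)`. Comparing the penalized likelihood at `η` with its value at
`η₀` gives `λ²J² - λ²J₀² ≤ (ℙ_n - P)D + P D`, and the curvature condition bounds `P D` by `-c d² + C
τ²`. So everything rests on the empirical term.

The normalized function `D / (B(1 + J))` takes values in `[-1, 1]` and runs through a class whose
bracketing entropy is of order `ε^(-1/k)`. For such a class, with `r = n^(-k/(2k+1))` and up to
small probability, `|(ℙ_n - P)f| ≲ r(r + ‖f‖₂)` uniformly
(`measure_exists_lt_abs_empDev_le_of_entropy`). Undoing the normalization gives `|(ℙ_n - P)D| ≲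
r(r(1 + J) + ‖D‖₂)`. Here `r ≲ λ` turns `r(1 + J)` into `λ + λJ`, and the Lipschitz condition gives
`‖D‖₂ ≲ τ + d`. With `s = λ + τ` the result is `c d² + (λJ)² ≲ s² + s(d + λJ)`, which forces `d + λJ
≲ s` (`rate_of_isPenalizedMLE`, `add_le_of_quadratic_le`).

The uniform bound comes from Bernstein's inequality and bracket chaining with adaptive truncation: a
function is refined along nested brackets only where their widths stay below thresholds `a i`. Where
a threshold is first exceeded, the old threshold still controls the sup norm, while exceeding the
new one makes the mean small. Geometric thresholds balance the two terms of Bernstein's denominator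
(`measure_exists_lt_abs_empDev_le_of_radius`), and dyadic peeling over `‖f‖₂` makes the bound
proportional to the norm. -/

namespace PenalizedRate

/-! ### Bernstein's inequality for the empirical process -/

section Empirical

variable {𝓧 Ω : Type*} [MeasurableSpace 𝓧] [MeasurableSpace Ω]

/-- The centred empirical mean `ℙ_n g - P g` of the observations `x 0, …, x (n - 1)`. -/
noncomputable def empDev (P : Measure 𝓧) (n : ℕ) (x : ℕ → 𝓧) (g : 𝓧 → ℝ) : ℝ :=
  (∑ i ∈ Finset.range n, g (x i)) / n - ∫ y, g y ∂P

lemma integrable_of_abs_le {P : Measure 𝓧} [IsFiniteMeasure P] {g : 𝓧 → ℝ} {b : ℝ}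
    (hg : Measurable g) (hb : ∀ x, |g x| ≤ b) : Integrable g P :=
  Integrable.of_bound hg.aestronglyMeasurable b (Eventually.of_forall hb)

lemma integrable_sq_of_abs_le {P : Measure 𝓧} [IsFiniteMeasure P] {g : 𝓧 → ℝ} {b : ℝ}
    (hg : Measurable g) (hb : ∀ x, |g x| ≤ b) : Integrable (fun x => g x ^ 2) P :=
  integrable_of_abs_le (b := b ^ 2) (hg.pow_const 2) fun x => by
    rw [abs_pow]; exact pow_le_pow_left₀ (abs_nonneg _) (hb x) 2

lemma empDev_add {P : Measure 𝓧} (n : ℕ) (x : ℕ → 𝓧) {g h : 𝓧 → ℝ}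
    (hg : Integrable g P) (hh : Integrable h P) :
    empDev P n x (fun y => g y + h y) = empDev P n x g + empDev P n x h := by
  unfold empDev
  rw [integral_add hg hh, Finset.sum_add_distrib]; ring

lemma empDev_const_mul {P : Measure 𝓧} (n : ℕ) (x : ℕ → 𝓧) (c : ℝ) (g : 𝓧 → ℝ) :
    empDev P n x (fun y => c * g y) = c * empDev P n x g := by
  unfold empDev
  rw [integral_const_mul, ← Finset.mul_sum]; ring

lemma empDev_neg {P : Measure 𝓧} (n : ℕ) (x : ℕ → 𝓧) (g : 𝓧 → ℝ) :
    empDev P n x (fun y => - g y) = - empDev P n x g := by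
  simpa using empDev_const_mul (P := P) n x (-1) g

/-- Comparison of the empirical processes at two ordered nonnegative functions. -/
lemma abs_empDev_le_of_le {P : Measure 𝓧} (n : ℕ) (x : ℕ → 𝓧) {g h : 𝓧 → ℝ}
    (hg : Integrable g P) (hh : Integrable h P) (h0 : ∀ y, 0 ≤ g y) (hgh : ∀ y, g y ≤ h y) :
    |empDev P n x g| ≤ |empDev P n x h| + ∫ y, h y ∂P := by
  have h1 : ∫ y, g y ∂P ≤ ∫ y, h y ∂P := integral_mono hg hh hgh
  have h2 : 0 ≤ ∫ y, g y ∂P := integral_nonneg h0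
  have h3 : (∑ i ∈ Finset.range n, g (x i)) / n ≤ (∑ i ∈ Finset.range n, h (x i)) / n := by
    gcongr with i _
    exact hgh _
  have h4 : 0 ≤ (∑ i ∈ Finset.range n, g (x i)) / n :=
    div_nonneg (Finset.sum_nonneg fun i _ => h0 _) (Nat.cast_nonneg _)
  have h5 := le_abs_self (empDev P n x h)
  have h6 := abs_nonneg (empDev P n x h)
  unfold empDev at *
  rw [abs_le]
  constructor <;> linarith

variable {μ : Measure Ω} [IsProbabilityMeasure μ] {P : Measure 𝓧} [IsProbabilityMeasure P]

/-- The moment generating function of a bounded centred variable. -/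
lemma mgf_centred_le {g : 𝓧 → ℝ} {b σ2 s : ℝ} (hg : Measurable g) (hb : ∀ x, |g x| ≤ b)
    (hσ : ∫ x, g x ^ 2 ∂P ≤ σ2) (hs0 : 0 ≤ s) (hs : s * (2 * b) ≤ 1) :
    mgf (fun x => g x - ∫ y, g y ∂P) P s ≤ Real.exp (s ^ 2 * σ2) := by
  set m := ∫ y, g y ∂P with hm
  have hgi : Integrable g P := integrable_of_abs_le hg hb
  have hmb : |m| ≤ b := by
    have := norm_integral_le_of_norm_le_const (μ := P) (f := g) (C := b) (Eventually.of_forall hb)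
    simpa using this
  have hY : ∀ x, |g x - m| ≤ 2 * b := fun x => by
    have := abs_sub (g x) m
    linarith [hb x]
  have hYi : Integrable (fun x => g x - m) P := hgi.sub (integrable_const m)
  have hY2i : Integrable (fun x => (g x - m) ^ 2) P :=
    integrable_sq_of_abs_le (hg.sub_const m) hY
  -- The bound `exp y ≤ 1 + y + y²` for `|y| ≤ 1`; the linear term integrates to zero.
  have hpt : ∀ x, Real.exp (s * (g x - m)) ≤ 1 + s * (g x - m) + s ^ 2 * (g x - m) ^ 2 := by
    intro x
    have h1 : |s * (g x - m)| ≤ 1 := by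
      rw [abs_mul, abs_of_nonneg hs0]
      exact (mul_le_mul_of_nonneg_left (hY x) hs0).trans hs
    have h2 := (abs_le.1 (Real.abs_exp_sub_one_sub_id_le h1)).2
    rw [mul_pow] at h2
    linarith
  have hvar : ∫ x, (g x - m) ^ 2 ∂P ≤ σ2 := by
    have h1 : ∫ x, (g x - m) ^ 2 ∂P = ∫ x, g x ^ 2 ∂P - m ^ 2 := by
      have : ∀ x, (g x - m) ^ 2 = g x ^ 2 - (2 * m * g x - m ^ 2) := fun x => by ring
      simp_rw [this]
      have hi : Integrable (fun x => 2 * m * g x - m ^ 2) P :=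
        (hgi.const_mul _).sub (integrable_const _)
      rw [integral_sub (integrable_sq_of_abs_le hg hb) hi,
        integral_sub (hgi.const_mul _) (integrable_const _), integral_const_mul, ← hm]
      simp
      ring
    nlinarith [sq_nonneg m]
  have hlin : ∫ x, (1 + s * (g x - m) + s ^ 2 * (g x - m) ^ 2) ∂P
      = 1 + s ^ 2 * ∫ x, (g x - m) ^ 2 ∂P := by
    have hi : Integrable (fun x => 1 + s * (g x - m)) P :=
      (integrable_const _).add (hYi.const_mul _)
    rw [integral_add hi (hY2i.const_mul _),
      integral_add (integrable_const _) (hYi.const_mul _), integral_const_mul, integral_const_mul,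
      integral_sub hgi (integrable_const m), ← hm]
    simp
  have hexpi : Integrable (fun x => Real.exp (s * (g x - m))) P := by
    refine integrable_of_abs_le (b := Real.exp 1) (by fun_prop) fun x => ?_
    rw [abs_of_pos (Real.exp_pos _)]
    refine Real.exp_le_exp.2 (le_trans ?_ hs)
    exact mul_le_mul_of_nonneg_left ((le_abs_self _).trans (hY x)) hs0
  calc mgf (fun x => g x - m) P s
      ≤ ∫ x, (1 + s * (g x - m) + s ^ 2 * (g x - m) ^ 2) ∂P :=
        integral_mono hexpi (((integrable_const _).add (hYi.const_mul _)).add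
          (hY2i.const_mul _)) hpt
    _ = 1 + s ^ 2 * ∫ x, (g x - m) ^ 2 ∂P := hlin
    _ ≤ s ^ 2 * σ2 + 1 := by nlinarith [mul_le_mul_of_nonneg_left hvar (sq_nonneg s)]
    _ ≤ _ := Real.add_one_le_exp _

variable {X : ℕ → Ω → 𝓧}

/-- One-sided Bernstein inequality. -/
lemma measure_lt_empDev_le (hX : ∀ i, Measurable (X i)) (hindep : iIndepFun X μ)
    (hlaw : ∀ i, Measure.map (X i) μ = P) {g : 𝓧 → ℝ} {b σ2 t : ℝ} {n : ℕ} (hn : 0 < n)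
    (hg : Measurable g) (hb0 : 0 < b) (ht : 0 < t) (hb : ∀ x, |g x| ≤ b)
    (hσ : ∫ x, g x ^ 2 ∂P ≤ σ2) :
    μ {ω | t < empDev P n (fun i => X i ω) g}
      ≤ ENNReal.ofReal (Real.exp (-(n * t ^ 2 / (4 * (σ2 + b * t))))) := by
  set m := ∫ y, g y ∂P with hm
  have hn' : (0 : ℝ) < n := Nat.cast_pos.2 hn
  have hσ0 : 0 ≤ σ2 := (integral_nonneg fun x => sq_nonneg (g x)).trans hσ
  have hbt : 0 < b * t := mul_pos hb0 ht
  -- This Chernoff parameter satisfies both `2bs ≤ 1`, as the moment bound requires, and `s σ2 ≤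
  -- t/2`, which leaves the exponent `n s t / 2`.
  set s := t / (2 * (σ2 + b * t)) with hs
  have hden : 0 < σ2 + b * t := by positivity
  have hs0 : 0 < s := by positivity
  have hsb : s * (2 * b) ≤ 1 := by
    rw [hs, div_mul_eq_mul_div, div_le_one (by positivity)]
    nlinarith
  let Y : ℕ → Ω → ℝ := fun i ω => g (X i ω) - m
  have hYm : ∀ i, Measurable (Y i) := fun i => (hg.comp (hX i)).sub_const m
  have hYind : iIndepFun Y μ := hindep.comp (fun _ x => g x - m) fun _ => hg.sub_const m
  have hmgf : ∀ i, mgf (Y i) μ s ≤ Real.exp (s ^ 2 * σ2) := by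
    intro i
    have h1 : mgf (Y i) μ s = mgf (fun x => g x - m) P s := by
      rw [← hlaw i, mgf_map (hX i).aemeasurable]
      · rfl
      · exact Measurable.aestronglyMeasurable (by fun_prop)
    rw [h1]
    exact mgf_centred_le hg hb hσ hs0.le hsb
  have hmb : |m| ≤ b := by
    have := norm_integral_le_of_norm_le_const (μ := P) (f := g) (C := b) (Eventually.of_forall hb)
    simpa using this
  have hYb : ∀ i ω, |Y i ω| ≤ 2 * b := fun i ω => by
    have := abs_sub (g (X i ω)) m
    have := hb (X i ω)
    simp only [Y]; linarith
  have hint : Integrable (fun ω => Real.exp (s * (∑ i ∈ Finset.range n, Y i) ω)) μ := by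
    refine integrable_of_abs_le (b := Real.exp (s * (n * (2 * b)))) ?_ fun ω => ?_
    · simp only [Finset.sum_apply]
      fun_prop
    · rw [abs_of_pos (Real.exp_pos _)]
      refine Real.exp_le_exp.2 (mul_le_mul_of_nonneg_left ?_ hs0.le)
      rw [Finset.sum_apply]
      refine (Finset.sum_le_card_nsmul _ _ (2 * b) fun i _ =>
        (le_abs_self _).trans (hYb i ω)).trans ?_
      simp
  have hch := measure_ge_le_exp_mul_mgf (μ := μ) (X := ∑ i ∈ Finset.range n, Y i) (n * t)
    hs0.le hint
  have hprod : mgf (∑ i ∈ Finset.range n, Y i) μ s ≤ Real.exp (n * (s ^ 2 * σ2)) := by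
    rw [hYind.mgf_sum hYm, Real.exp_nat_mul]
    refine (Finset.prod_le_prod (fun i _ => mgf_nonneg) fun i _ => hmgf i).trans ?_
    simp
  have hsub : {ω | t < empDev P n (fun i => X i ω) g}
      ⊆ {ω | n * t ≤ (∑ i ∈ Finset.range n, Y i) ω} := by
    intro ω hω
    simp only [mem_ofPred_eq, empDev] at hω ⊢
    rw [Finset.sum_apply]
    simp only [Y, Finset.sum_sub_distrib, Finset.sum_const, Finset.card_range, nsmul_eq_mul]
    rw [lt_sub_iff_add_lt, lt_div_iff₀ hn'] at hω
    rw [← hm] at hω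
    nlinarith
  refine (measure_mono hsub).trans ?_
  rw [← ofReal_measureReal]
  refine ENNReal.ofReal_le_ofReal (hch.trans ?_)
  calc Real.exp (-s * (n * t)) * mgf (∑ i ∈ Finset.range n, Y i) μ s
      ≤ Real.exp (-s * (n * t)) * Real.exp (n * (s ^ 2 * σ2)) := by gcongr
    _ = Real.exp (-(n * (s * (t - s * σ2)))) := by rw [← Real.exp_add]; ring_nf
    _ ≤ _ := by
      refine Real.exp_le_exp.2 (neg_le_neg ?_)
      rw [mul_div_assoc]
      refine mul_le_mul_of_nonneg_left ?_ hn'.le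
      have h1 : s * σ2 ≤ t / 2 := by
        rw [hs, div_mul_eq_mul_div, div_le_div_iff₀ (by positivity) (by norm_num)]
        nlinarith [mul_pos hbt ht]
      have h2 : t ^ 2 / (4 * (σ2 + b * t)) = s * (t / 2) := by
        rw [hs]; field_simp; norm_num
      rw [h2]
      exact mul_le_mul_of_nonneg_left (by linarith) hs0.le

/-- Two-sided Bernstein inequality. -/
lemma measure_lt_abs_empDev_le (hX : ∀ i, Measurable (X i)) (hindep : iIndepFun X μ)
    (hlaw : ∀ i, Measure.map (X i) μ = P) {g : 𝓧 → ℝ} {b σ2 t : ℝ} {n : ℕ} (hn : 0 < n)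
    (hg : Measurable g) (hb0 : 0 < b) (ht : 0 < t) (hb : ∀ x, |g x| ≤ b)
    (hσ : ∫ x, g x ^ 2 ∂P ≤ σ2) :
    μ {ω | t < |empDev P n (fun i => X i ω) g|}
      ≤ ENNReal.ofReal (2 * Real.exp (-(n * t ^ 2 / (4 * (σ2 + b * t))))) := by
  have h1 := measure_lt_empDev_le hX hindep hlaw hn hg hb0 ht hb hσ
  have h2 := measure_lt_empDev_le hX hindep hlaw (g := fun x => - g x) hn hg.neg hb0 ht
    (by simpa using hb) (by simpa using hσ)
  have hsub : {ω | t < |empDev P n (fun i => X i ω) g|}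
      ⊆ {ω | t < empDev P n (fun i => X i ω) g}
        ∪ {ω | t < empDev P n (fun i => X i ω) (fun x => - g x)} := by
    intro ω hω
    simp only [mem_ofPred_eq, mem_union, empDev_neg] at hω ⊢
    exact lt_abs.1 hω
  refine (measure_mono hsub).trans ((measure_union_le _ _).trans ((add_le_add h1 h2).trans ?_))
  rw [← ENNReal.ofReal_add (Real.exp_pos _).le (Real.exp_pos _).le, two_mul]

/-- Bernstein's inequality, uniformly over a finite class. -/
lemma measure_exists_lt_abs_empDev_le (hX : ∀ i, Measurable (X i)) (hindep : iIndepFun X μ)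
    (hlaw : ∀ i, Measure.map (X i) μ = P) {G : Finset (𝓧 → ℝ)} {b σ2 t N : ℝ} {n : ℕ}
    (hn : 0 < n) (hb0 : 0 < b) (ht : 0 < t) (hcard : (G.card : ℝ) ≤ N)
    (hG : ∀ g ∈ G, Measurable g ∧ (∀ x, |g x| ≤ b) ∧ ∫ x, g x ^ 2 ∂P ≤ σ2) :
    μ {ω | ∃ g ∈ G, t < |empDev P n (fun i => X i ω) g|}
      ≤ ENNReal.ofReal (N * (2 * Real.exp (-(n * t ^ 2 / (4 * (σ2 + b * t)))))) := by
  have hsub : {ω | ∃ g ∈ G, t < |empDev P n (fun i => X i ω) g|}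
      = ⋃ g ∈ G, {ω | t < |empDev P n (fun i => X i ω) g|} := by
    ext ω; simp
  rw [hsub]
  refine (measure_biUnion_finset_le _ _).trans ((Finset.sum_le_card_nsmul _ _ _ fun g hg =>
    measure_lt_abs_empDev_le hX hindep hlaw hn (hG g hg).1 hb0 ht (hG g hg).2.1
      (hG g hg).2.2).trans ?_)
  rw [nsmul_eq_mul, ENNReal.ofReal_mul ((Nat.cast_nonneg _).trans hcard)]
  gcongr
  rw [← ENNReal.ofReal_natCast]
  exact ENNReal.ofReal_le_ofReal hcard

end Empirical

/-! ### Chaining with brackets -/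

section Chaining

variable {𝓧 : Type*}

/-- The running maximum of the lower ends of a sequence of brackets. -/
def lowerEnv (s : ℕ → (𝓧 → ℝ) × (𝓧 → ℝ)) : ℕ → 𝓧 → ℝ
  | 0 => (s 0).1
  | i + 1 => fun x => max (lowerEnv s i x) ((s (i + 1)).1 x)

/-- The running minimum of the upper ends of a sequence of brackets. -/
def upperEnv (s : ℕ → (𝓧 → ℝ) × (𝓧 → ℝ)) : ℕ → 𝓧 → ℝ
  | 0 => (s 0).2
  | i + 1 => fun x => min (upperEnv s i x) ((s (i + 1)).2 x)

/-- The points at which the first `i + 1` running brackets have width at most `a`. -/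
def tameSet (a : ℕ → ℝ) (s : ℕ → (𝓧 → ℝ) × (𝓧 → ℝ)) (i : ℕ) : Set 𝓧 :=
  {x | ∀ j ≤ i, upperEnv s j x - lowerEnv s j x ≤ a j}

/-- The truncated step from level `i` to level `i + 1` of a chain. -/
noncomputable def chainLink (a : ℕ → ℝ) (s : ℕ → (𝓧 → ℝ) × (𝓧 → ℝ)) (i : ℕ) : 𝓧 → ℝ :=
  (tameSet a s i).indicator fun x => lowerEnv s (i + 1) x - lowerEnv s i x

/-- The width of the running bracket where it first exceeds `a` at level `i + 1`. -/
noncomputable def chainExcess (a : ℕ → ℝ) (s : ℕ → (𝓧 → ℝ) × (𝓧 → ℝ)) (i : ℕ) : 𝓧 → ℝ :=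
  (tameSet a s i \ tameSet a s (i + 1)).indicator
    fun x => upperEnv s (i + 1) x - lowerEnv s (i + 1) x

/-- The truncated width of the running bracket at level `i`. -/
noncomputable def chainWidth (a : ℕ → ℝ) (s : ℕ → (𝓧 → ℝ) × (𝓧 → ℝ)) (i : ℕ) : 𝓧 → ℝ :=
  (tameSet a s i).indicator fun x => upperEnv s i x - lowerEnv s i x

/-- A running envelope at level `i` reads only brackets `0, …, i`. This locality and its
consequences below make the possible chain steps at each level a finite family. -/
lemma lowerEnv_congr {s s' : ℕ → (𝓧 → ℝ) × (𝓧 → ℝ)} {i : ℕ} (h : ∀ j ≤ i, s j = s' j) :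
    lowerEnv s i = lowerEnv s' i := by
  induction i with
  | zero => simp [lowerEnv, h 0 le_rfl]
  | succ i ih => simp [lowerEnv, ih fun j hj => h j (by omega), h (i + 1) le_rfl]

lemma upperEnv_congr {s s' : ℕ → (𝓧 → ℝ) × (𝓧 → ℝ)} {i : ℕ} (h : ∀ j ≤ i, s j = s' j) :
    upperEnv s i = upperEnv s' i := by
  induction i with
  | zero => simp [upperEnv, h 0 le_rfl]
  | succ i ih => simp [upperEnv, ih fun j hj => h j (by omega), h (i + 1) le_rfl]

lemma tameSet_congr {a : ℕ → ℝ} {s s' : ℕ → (𝓧 → ℝ) × (𝓧 → ℝ)} {i : ℕ}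
    (h : ∀ j ≤ i, s j = s' j) : tameSet a s i = tameSet a s' i := by
  ext x
  refine forall₂_congr fun j hj => ?_
  rw [lowerEnv_congr fun l hl => h l (hl.trans hj), upperEnv_congr fun l hl => h l (hl.trans hj)]

lemma chainLink_congr {a : ℕ → ℝ} {s s' : ℕ → (𝓧 → ℝ) × (𝓧 → ℝ)} {i : ℕ}
    (h : ∀ j ≤ i + 1, s j = s' j) : chainLink a s i = chainLink a s' i := by
  have h' : ∀ j ≤ i, s j = s' j := fun j hj => h j (by omega)
  rw [chainLink, chainLink, tameSet_congr h', lowerEnv_congr h', lowerEnv_congr h]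

lemma chainExcess_congr {a : ℕ → ℝ} {s s' : ℕ → (𝓧 → ℝ) × (𝓧 → ℝ)} {i : ℕ}
    (h : ∀ j ≤ i + 1, s j = s' j) : chainExcess a s i = chainExcess a s' i := by
  have h' : ∀ j ≤ i, s j = s' j := fun j hj => h j (by omega)
  rw [chainExcess, chainExcess, tameSet_congr h', tameSet_congr h, lowerEnv_congr h,
    upperEnv_congr h]

/-- Agreement up to `i` would suffice; the extra index matches the tuples of length `i + 2` shared
by all the families at level `i`. -/
lemma chainWidth_congr {a : ℕ → ℝ} {s s' : ℕ → (𝓧 → ℝ) × (𝓧 → ℝ)} {i : ℕ}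
    (h : ∀ j ≤ i + 1, s j = s' j) : chainWidth a s i = chainWidth a s' i := by
  have h' : ∀ j ≤ i, s j = s' j := fun j hj => h j (by omega)
  rw [chainWidth, chainWidth, tameSet_congr h', lowerEnv_congr h', upperEnv_congr h']

lemma lowerEnv_le_succ (s : ℕ → (𝓧 → ℝ) × (𝓧 → ℝ)) (i : ℕ) (x : 𝓧) :
    lowerEnv s i x ≤ lowerEnv s (i + 1) x := le_max_left _ _

lemma upperEnv_succ_le (s : ℕ → (𝓧 → ℝ) × (𝓧 → ℝ)) (i : ℕ) (x : 𝓧) :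
    upperEnv s (i + 1) x ≤ upperEnv s i x := min_le_left _ _

lemma tameSet_succ_subset (a : ℕ → ℝ) (s : ℕ → (𝓧 → ℝ) × (𝓧 → ℝ)) (i : ℕ) :
    tameSet a s (i + 1) ⊆ tameSet a s i := fun _ hx j hj => hx j (by omega)

/-- All thresholds up to `i` hold at such a point, so the one that fails must be the newest. -/
lemma lt_of_mem_tameSet_diff {a : ℕ → ℝ} {s : ℕ → (𝓧 → ℝ) × (𝓧 → ℝ)} {i : ℕ} {x : 𝓧}
    (hx : x ∈ tameSet a s i \ tameSet a s (i + 1)) :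
    a (i + 1) < upperEnv s (i + 1) x - lowerEnv s (i + 1) x := by
  by_contra h
  refine hx.2 fun j hj => ?_
  rcases Nat.lt_or_ge i j with h1 | h1
  · obtain rfl : j = i + 1 := by omega
    exact not_lt.1 h
  · exact hx.1 j h1

lemma lowerEnv_le {s : ℕ → (𝓧 → ℝ) × (𝓧 → ℝ)} {f : 𝓧 → ℝ}
    (hf : ∀ j x, (s j).1 x ≤ f x ∧ f x ≤ (s j).2 x) (i : ℕ) (x : 𝓧) : lowerEnv s i x ≤ f x := by
  induction i with
  | zero => exact (hf 0 x).1
  | succ i ih => exact max_le ih (hf (i + 1) x).1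

lemma le_upperEnv {s : ℕ → (𝓧 → ℝ) × (𝓧 → ℝ)} {f : 𝓧 → ℝ}
    (hf : ∀ j x, (s j).1 x ≤ f x ∧ f x ≤ (s j).2 x) (i : ℕ) (x : 𝓧) : f x ≤ upperEnv s i x := by
  induction i with
  | zero => exact (hf 0 x).2
  | succ i ih => exact le_min ih (hf (i + 1) x).2

lemma le_lowerEnv (s : ℕ → (𝓧 → ℝ) × (𝓧 → ℝ)) (i : ℕ) (x : 𝓧) :
    (s i).1 x ≤ lowerEnv s i x := by
  cases i with
  | zero => exact le_rfl
  | succ i => exact le_max_right _ _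

lemma upperEnv_le (s : ℕ → (𝓧 → ℝ) × (𝓧 → ℝ)) (i : ℕ) (x : 𝓧) :
    upperEnv s i x ≤ (s i).2 x := by
  cases i with
  | zero => exact le_rfl
  | succ i => exact min_le_right _ _

lemma abs_lowerEnv_le {s : ℕ → (𝓧 → ℝ) × (𝓧 → ℝ)} (h : ∀ j x, |(s j).1 x| ≤ 1) (i : ℕ) (x : 𝓧) :
    |lowerEnv s i x| ≤ 1 := by
  induction i with
  | zero => exact h 0 x
  | succ i ih => exact abs_max_le_max_abs_abs.trans (max_le ih (h _ x))

lemma abs_upperEnv_le {s : ℕ → (𝓧 → ℝ) × (𝓧 → ℝ)} (h : ∀ j x, |(s j).2 x| ≤ 1) (i : ℕ) (x : 𝓧) :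
    |upperEnv s i x| ≤ 1 := by
  induction i with
  | zero => exact h 0 x
  | succ i ih => exact abs_min_le_max_abs_abs.trans (max_le ih (h _ x))

variable [MeasurableSpace 𝓧]

lemma measurable_lowerEnv {s : ℕ → (𝓧 → ℝ) × (𝓧 → ℝ)} (h : ∀ j, Measurable (s j).1) (i : ℕ) :
    Measurable (lowerEnv s i) := by
  induction i with
  | zero => exact h 0
  | succ i ih => exact ih.max (h (i + 1))

lemma measurable_upperEnv {s : ℕ → (𝓧 → ℝ) × (𝓧 → ℝ)} (h : ∀ j, Measurable (s j).2) (i : ℕ) :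
    Measurable (upperEnv s i) := by
  induction i with
  | zero => exact h 0
  | succ i ih => exact ih.min (h (i + 1))

lemma measurableSet_tameSet {a : ℕ → ℝ} {s : ℕ → (𝓧 → ℝ) × (𝓧 → ℝ)}
    (h₁ : ∀ j, Measurable (s j).1) (h₂ : ∀ j, Measurable (s j).2) (i : ℕ) :
    MeasurableSet (tameSet a s i) := by
  have : tameSet a s i = ⋂ j, ⋂ (_ : j ≤ i), {x | upperEnv s j x - lowerEnv s j x ≤ a j} := by
    ext x; simp [tameSet]
  rw [this]
  exact MeasurableSet.iInter fun j => MeasurableSet.iInter fun _ =>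
    measurableSet_le ((measurable_upperEnv h₂ j).sub (measurable_lowerEnv h₁ j)) measurable_const

/-- `S` is a finite set of measurable brackets with values in `[-1, 1]` and `L₂(P)`-width at most
`ε` that covers the class `F`. -/
structure IsBracketCover (P : Measure 𝓧) (F : Set (𝓧 → ℝ)) (ε : ℝ)
    (S : Finset ((𝓧 → ℝ) × (𝓧 → ℝ))) : Prop where
  measurable_fst : ∀ s ∈ S, Measurable s.1
  measurable_snd : ∀ s ∈ S, Measurable s.2
  abs_fst_le : ∀ s ∈ S, ∀ x, |s.1 x| ≤ 1
  abs_snd_le : ∀ s ∈ S, ∀ x, |s.2 x| ≤ 1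
  integral_le : ∀ s ∈ S, ∫ x, (s.2 x - s.1 x) ^ 2 ∂P ≤ ε ^ 2
  exists_mem : ∀ f ∈ F, ∃ s ∈ S, ∀ x, s.1 x ≤ f x ∧ f x ≤ s.2 x

lemma integral_indicator_sq_le {P : Measure 𝓧} {A : Set 𝓧} {g h : 𝓧 → ℝ} {e : ℝ}
    (hgh : ∀ x, |g x| ≤ |h x|) (hh : Integrable (fun x => h x ^ 2) P)
    (he : ∫ x, h x ^ 2 ∂P ≤ e) : ∫ x, (A.indicator g x) ^ 2 ∂P ≤ e := by
  refine (integral_mono_of_nonneg (Eventually.of_forall fun x => sq_nonneg _) hh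
    (Eventually.of_forall fun x => ?_)).trans he
  by_cases hx : x ∈ A
  · simp only [indicator_of_mem hx]
    exact sq_le_sq.2 (hgh x)
  · simpa [indicator_of_notMem hx] using sq_nonneg (h x)

variable {P : Measure 𝓧} [IsProbabilityMeasure P]

section Members

variable {F : Set (𝓧 → ℝ)} {ε a : ℕ → ℝ} {S : ℕ → Finset ((𝓧 → ℝ) × (𝓧 → ℝ))}
  {s : ℕ → (𝓧 → ℝ) × (𝓧 → ℝ)} {f : 𝓧 → ℝ}

lemma integrable_width_sq (hS : ∀ i, IsBracketCover P F (ε i) (S i)) (hs : ∀ i, s i ∈ S i) (i : ℕ) :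
    Integrable (fun x => (upperEnv s i x - lowerEnv s i x) ^ 2) P :=
  integrable_sq_of_abs_le (b := 2)
    ((measurable_upperEnv (fun j => (hS j).measurable_snd _ (hs j)) i).sub
      (measurable_lowerEnv (fun j => (hS j).measurable_fst _ (hs j)) i)) fun x => by
    have h1 := abs_upperEnv_le (fun j => (hS j).abs_snd_le _ (hs j)) i x
    have h2 := abs_lowerEnv_le (fun j => (hS j).abs_fst_le _ (hs j)) i x
    have h3 := abs_sub (upperEnv s i x) (lowerEnv s i x)
    linarith

lemma integral_width_sq_le (hS : ∀ i, IsBracketCover P F (ε i) (S i)) (hs : ∀ i, s i ∈ S i)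
    (hf : ∀ j x, (s j).1 x ≤ f x ∧ f x ≤ (s j).2 x) (i : ℕ) :
    ∫ x, (upperEnv s i x - lowerEnv s i x) ^ 2 ∂P ≤ ε i ^ 2 := by
  refine (integral_mono (integrable_width_sq hS hs i) ?_ fun x => ?_).trans
    ((hS i).integral_le _ (hs i))
  · refine integrable_sq_of_abs_le (b := 2) (((hS i).measurable_snd _ (hs i)).sub
      ((hS i).measurable_fst _ (hs i))) fun x => ?_
    have h1 := (hS i).abs_snd_le _ (hs i) x
    have h2 := (hS i).abs_fst_le _ (hs i) x
    have h3 := abs_sub ((s i).2 x) ((s i).1 x)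
    linarith
  · have h1 := lowerEnv_le hf i x
    have h2 := le_upperEnv hf i x
    exact pow_le_pow_left₀ (by linarith) (sub_le_sub (upperEnv_le s i x) (le_lowerEnv s i x)) 2

/-- The properties of the members of the classes to which Bernstein's inequality is applied. -/
def IsChainMember (P : Measure 𝓧) (b σ2 : ℝ) (g : 𝓧 → ℝ) : Prop :=
  Measurable g ∧ (∀ x, |g x| ≤ b) ∧ ∫ x, g x ^ 2 ∂P ≤ σ2

lemma isChainMember_lowerEnv_zero (hS : ∀ i, IsBracketCover P F (ε i) (S i)) (hs : ∀ i, s i ∈ S i)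
    (hf : ∀ j x, (s j).1 x ≤ f x ∧ f x ≤ (s j).2 x) (hfm : Measurable f)
    (hf1 : ∀ x, |f x| ≤ 1) (hfε : ∫ x, f x ^ 2 ∂P ≤ ε 0 ^ 2) (ha0 : 2 ≤ a 0) :
    IsChainMember P (a 0) (4 * ε 0 ^ 2) (lowerEnv s 0) := by
  have hm := measurable_lowerEnv (fun j => (hS j).measurable_fst _ (hs j)) 0
  have hb := abs_lowerEnv_le (fun j => (hS j).abs_fst_le _ (hs j)) 0
  refine ⟨hm, fun x => (hb x).trans (by linarith), ?_⟩
  have h1 := integrable_width_sq hS hs 0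
  have h2 := integrable_sq_of_abs_le (P := P) hfm hf1
  calc ∫ x, lowerEnv s 0 x ^ 2 ∂P
      ≤ ∫ x, (2 * f x ^ 2 + 2 * (upperEnv s 0 x - lowerEnv s 0 x) ^ 2) ∂P := by
        refine integral_mono (integrable_sq_of_abs_le hm hb)
          ((h2.const_mul 2).add (h1.const_mul 2)) fun x => ?_
        have h3 := lowerEnv_le hf 0 x
        have h4 := le_upperEnv hf 0 x
        have h5 : (f x - lowerEnv s 0 x) ^ 2 ≤ (upperEnv s 0 x - lowerEnv s 0 x) ^ 2 :=
          pow_le_pow_left₀ (by linarith) (by linarith) 2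
        -- With `l` the lower envelope, `2f² + 2(f - l)² - l² = (2f - l)²`.
        have h6 := sq_nonneg (2 * f x - lowerEnv s 0 x)
        nlinarith
    _ ≤ 4 * ε 0 ^ 2 := by
        rw [integral_add (h2.const_mul 2) (h1.const_mul 2), integral_const_mul, integral_const_mul]
        linarith [integral_width_sq_le hS hs hf 0]

/-- Since `f` lies in every running bracket, a rise of the lower envelope is at most the old width,
which tameness bounds by `a i`. The factor 4 is needed only for the starting function and is kept so
that all families share one variance bound. -/
lemma isChainMember_chainLink (hS : ∀ i, IsBracketCover P F (ε i) (S i)) (hs : ∀ i, s i ∈ S i)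
    (hf : ∀ j x, (s j).1 x ≤ f x ∧ f x ≤ (s j).2 x) (ha : ∀ i, 0 < a i) (i : ℕ) :
    IsChainMember P (a i) (4 * ε i ^ 2) (chainLink a s i) := by
  have hm₁ := fun j => (hS j).measurable_fst _ (hs j)
  have hm₂ := fun j => (hS j).measurable_snd _ (hs j)
  have hle : ∀ x, 0 ≤ lowerEnv s (i + 1) x - lowerEnv s i x ∧
      lowerEnv s (i + 1) x - lowerEnv s i x ≤ upperEnv s i x - lowerEnv s i x := fun x => by
    have h1 := lowerEnv_le_succ s i x
    have h2 := lowerEnv_le hf (i + 1) x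
    have h3 := le_upperEnv hf i x
    constructor <;> linarith
  refine ⟨((measurable_lowerEnv hm₁ _).sub (measurable_lowerEnv hm₁ _)).indicator
    (measurableSet_tameSet hm₁ hm₂ i), fun x => ?_, ?_⟩
  · by_cases hx : x ∈ tameSet a s i
    · rw [chainLink, indicator_of_mem hx, abs_of_nonneg (hle x).1]
      exact (hle x).2.trans (hx i le_rfl)
    · rw [chainLink, indicator_of_notMem hx, abs_zero]
      exact (ha i).le
  · refine integral_indicator_sq_le (fun x => ?_) (integrable_width_sq hS hs i)
      ((integral_width_sq_le hS hs hf i).trans (by nlinarith [sq_nonneg (ε i)]))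
    rw [abs_of_nonneg (hle x).1, abs_of_nonneg ((hle x).1.trans (hle x).2)]
    exact (hle x).2

/-- The new width may exceed `a (i + 1)`, but it is at most the old width, still bounded by `a i` on
this set. -/
lemma isChainMember_chainExcess (hS : ∀ i, IsBracketCover P F (ε i) (S i)) (hs : ∀ i, s i ∈ S i)
    (hf : ∀ j x, (s j).1 x ≤ f x ∧ f x ≤ (s j).2 x) (ha : ∀ i, 0 < a i) (i : ℕ) :
    IsChainMember P (a i) (4 * ε i ^ 2) (chainExcess a s i) := by
  have hm₁ := fun j => (hS j).measurable_fst _ (hs j)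
  have hm₂ := fun j => (hS j).measurable_snd _ (hs j)
  have hle : ∀ x, 0 ≤ upperEnv s (i + 1) x - lowerEnv s (i + 1) x ∧
      upperEnv s (i + 1) x - lowerEnv s (i + 1) x ≤ upperEnv s i x - lowerEnv s i x := fun x => by
    have h1 := lowerEnv_le_succ s i x
    have h2 := upperEnv_succ_le s i x
    have h3 := lowerEnv_le hf (i + 1) x
    have h4 := le_upperEnv hf (i + 1) x
    constructor <;> linarith
  refine ⟨((measurable_upperEnv hm₂ _).sub (measurable_lowerEnv hm₁ _)).indicator
    ((measurableSet_tameSet hm₁ hm₂ i).diff (measurableSet_tameSet hm₁ hm₂ _)), fun x => ?_, ?_⟩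
  · by_cases hx : x ∈ tameSet a s i \ tameSet a s (i + 1)
    · rw [chainExcess, indicator_of_mem hx, abs_of_nonneg (hle x).1]
      exact (hle x).2.trans (hx.1 i le_rfl)
    · rw [chainExcess, indicator_of_notMem hx, abs_zero]
      exact (ha i).le
  · refine integral_indicator_sq_le (fun x => ?_) (integrable_width_sq hS hs i)
      ((integral_width_sq_le hS hs hf i).trans (by nlinarith [sq_nonneg (ε i)]))
    rw [abs_of_nonneg (hle x).1, abs_of_nonneg ((hle x).1.trans (hle x).2)]
    exact (hle x).2

lemma isChainMember_chainWidth (hS : ∀ i, IsBracketCover P F (ε i) (S i)) (hs : ∀ i, s i ∈ S i)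
    (hf : ∀ j x, (s j).1 x ≤ f x ∧ f x ≤ (s j).2 x) (ha : ∀ i, 0 < a i) (i : ℕ) :
    IsChainMember P (a i) (4 * ε i ^ 2) (chainWidth a s i) := by
  have hm₁ := fun j => (hS j).measurable_fst _ (hs j)
  have hm₂ := fun j => (hS j).measurable_snd _ (hs j)
  refine ⟨((measurable_upperEnv hm₂ _).sub (measurable_lowerEnv hm₁ _)).indicator
    (measurableSet_tameSet hm₁ hm₂ i), fun x => ?_, ?_⟩
  · by_cases hx : x ∈ tameSet a s i
    · rw [chainWidth, indicator_of_mem hx, abs_of_nonneg]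
      · exact hx i le_rfl
      · exact sub_nonneg.2 ((lowerEnv_le hf i x).trans (le_upperEnv hf i x))
    · rw [chainWidth, indicator_of_notMem hx, abs_zero]
      exact (ha i).le
  · exact integral_indicator_sq_le (fun x => le_rfl) (integrable_width_sq hS hs i)
      ((integral_width_sq_le hS hs hf i).trans (by nlinarith [sq_nonneg (ε i)]))

/-- A Markov-type bound: where the width `y` exceeds `a (i + 1)`, one has `y ≤ y² / a (i + 1)`. -/
lemma integral_chainExcess_le (hS : ∀ i, IsBracketCover P F (ε i) (S i)) (hs : ∀ i, s i ∈ S i)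
    (hf : ∀ j x, (s j).1 x ≤ f x ∧ f x ≤ (s j).2 x) (ha : ∀ i, 0 < a i) (i : ℕ) :
    ∫ x, chainExcess a s i x ∂P ≤ ε (i + 1) ^ 2 / a (i + 1) := by
  have hai := ha (i + 1)
  calc ∫ x, chainExcess a s i x ∂P
      ≤ ∫ x, (upperEnv s (i + 1) x - lowerEnv s (i + 1) x) ^ 2 / a (i + 1) ∂P := by
        obtain ⟨h1, h2, -⟩ := isChainMember_chainExcess hS hs hf ha i
        refine integral_mono (integrable_of_abs_le h1 h2)
          ((integrable_width_sq hS hs _).div_const _) fun x => ?_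
        by_cases hx : x ∈ tameSet a s i \ tameSet a s (i + 1)
        · rw [chainExcess, indicator_of_mem hx, le_div_iff₀ hai, sq]
          have h3 := lt_of_mem_tameSet_diff hx
          exact mul_le_mul_of_nonneg_left h3.le (hai.le.trans h3.le)
        · rw [chainExcess, indicator_of_notMem hx]
          positivity
    _ ≤ _ := by
        rw [integral_div]
        gcongr
        exact integral_width_sq_le hS hs hf (i + 1)

lemma integral_chainWidth_le (hS : ∀ i, IsBracketCover P F (ε i) (S i)) (hs : ∀ i, s i ∈ S i)
    (hf : ∀ j x, (s j).1 x ≤ f x ∧ f x ≤ (s j).2 x) (ha : ∀ i, 0 < a i) {i : ℕ} (hε : 0 < ε i) :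
    ∫ x, chainWidth a s i x ∂P ≤ ε i := by
  obtain ⟨h1, h2, -⟩ := isChainMember_chainWidth hS hs hf ha i
  have hi := integrable_width_sq hS hs i
  calc ∫ x, chainWidth a s i x ∂P
      ≤ ∫ x, ((upperEnv s i x - lowerEnv s i x) ^ 2 / (2 * ε i) + ε i / 2) ∂P := by
        refine integral_mono (integrable_of_abs_le h1 h2)
          ((hi.div_const _).add (integrable_const _)) fun x => ?_
        have h3 : chainWidth a s i x ≤ upperEnv s i x - lowerEnv s i x := by
          by_cases hx : x ∈ tameSet a s i
          · rw [chainWidth, indicator_of_mem hx]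
          · rw [chainWidth, indicator_of_notMem hx]
            exact sub_nonneg.2 ((lowerEnv_le hf i x).trans (le_upperEnv hf i x))
        refine h3.trans ?_
        set y := upperEnv s i x - lowerEnv s i x
        -- Completing the square replaces the Cauchy–Schwarz inequality between the `L₁` and `L₂`
        -- norms.
        have : y ^ 2 / (2 * ε i) + ε i / 2 - y = (y - ε i) ^ 2 / (2 * ε i) := by
          field_simp; ring
        have h4 : 0 ≤ (y - ε i) ^ 2 / (2 * ε i) := by positivity
        linarith
    _ ≤ ε i ^ 2 / (2 * ε i) + ε i / 2 := by
        rw [integral_add (hi.div_const _) (integrable_const _), integral_div]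
        have := integral_width_sq_le hS hs hf i
        simp only [integral_const, probReal_univ, smul_eq_mul, one_mul]
        gcongr
    _ = ε i := by field_simp; norm_num

/-- The chaining bound along one chain. -/
lemma abs_empDev_le_of_chain (hS : ∀ i, IsBracketCover P F (ε i) (S i)) (hs : ∀ i, s i ∈ S i)
    (hf : ∀ j x, (s j).1 x ≤ f x ∧ f x ≤ (s j).2 x) (hfm : Measurable f)
    (hf1 : ∀ x, |f x| ≤ 1) (ha : ∀ i, 0 < a i) (ha0 : 2 ≤ a 0) {t : ℕ → ℝ} {n Q : ℕ}
    (hε : 0 < ε Q) {x : ℕ → 𝓧} (h0 : |empDev P n x (lowerEnv s 0)| ≤ t 0)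
    (hlink : ∀ i < Q, |empDev P n x (chainLink a s i)| ≤ t i)
    (hexcess : ∀ i < Q, |empDev P n x (chainExcess a s i)| ≤ t i)
    (hwidth : |empDev P n x (chainWidth a s Q)| ≤ t Q) :
    |empDev P n x f| ≤ t 0 + ∑ i ∈ Finset.range Q, (2 * t i + ε (i + 1) ^ 2 / a (i + 1))
      + (t Q + ε Q) := by
  have hm₁ := fun j => (hS j).measurable_fst _ (hs j)
  have hm₂ := fun j => (hS j).measurable_snd _ (hs j)
  have hb₁ := abs_lowerEnv_le fun j => (hS j).abs_fst_le _ (hs j)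
  have hb₂ := abs_upperEnv_le fun j => (hS j).abs_snd_le _ (hs j)
  have hlo := lowerEnv_le hf
  have hup := le_upperEnv hf
  have hrem : ∀ i (A : Set 𝓧), MeasurableSet A →
      Integrable (A.indicator fun y => f y - lowerEnv s i y) P := fun i A hA =>
    (integrable_of_abs_le (b := 2) (hfm.sub (measurable_lowerEnv hm₁ i)) fun y => by
      have h1 := abs_sub (f y) (lowerEnv s i y)
      have h2 := hf1 y
      have h3 := hb₁ i y
      exact h1.trans (by linarith)).indicator hA
  have hA := measurableSet_tameSet (a := a) hm₁ hm₂
  let R : ℕ → ℝ := fun i =>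
    |empDev P n x ((tameSet a s i).indicator fun y => f y - lowerEnv s i y)|
  have hstep : ∀ i < Q, R i ≤ 2 * t i + ε (i + 1) ^ 2 / a (i + 1) + R (i + 1) := by
    intro i hi
    obtain ⟨hl1, hl2, -⟩ := isChainMember_chainLink hS hs hf ha i
    obtain ⟨he1, he2, -⟩ := isChainMember_chainExcess hS hs hf ha i
    have hli := integrable_of_abs_le (P := P) hl1 hl2
    have hei := integrable_of_abs_le (P := P) he1 he2
    set g₂ := (tameSet a s i \ tameSet a s (i + 1)).indicator
      fun y => f y - lowerEnv s (i + 1) y with hg₂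
    set g₃ := (tameSet a s (i + 1)).indicator fun y => f y - lowerEnv s (i + 1) y with hg₃
    have hg₂i : Integrable g₂ P := hrem _ _ ((hA i).diff (hA (i + 1)))
    have hg₃i : Integrable g₃ P := hrem _ _ (hA (i + 1))
    -- The remainder at level `i` splits into the link to the next lower envelope, the new remainder
    -- where tameness is just lost, and the new remainder where it persists. The second is dominated
    -- by `chainExcess`; the third is passed on to the next level.
    have hdec : ((tameSet a s i).indicator fun y => f y - lowerEnv s i y)
        = fun y => chainLink a s i y + (g₂ y + g₃ y) := by
      funext y
      by_cases h1 : y ∈ tameSet a s (i + 1)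
      · have h2 := tameSet_succ_subset a s i h1
        simp [hg₂, hg₃, chainLink, h1, h2]
      · by_cases h2 : y ∈ tameSet a s i <;> simp [hg₂, hg₃, chainLink, h1, h2]
    have hg₂le : |empDev P n x g₂| ≤ t i + ε (i + 1) ^ 2 / a (i + 1) := by
      refine (abs_empDev_le_of_le n x hg₂i hei (fun y => ?_) fun y => ?_).trans
        (add_le_add (hexcess i hi) (integral_chainExcess_le hS hs hf ha i))
      · exact indicator_nonneg (fun y _ => sub_nonneg.2 (hlo _ y)) y
      · exact indicator_le_indicator (sub_le_sub_right (hup _ y) _)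
    have : R i ≤ |empDev P n x (chainLink a s i)| + (|empDev P n x g₂| + R (i + 1)) := by
      change |empDev P n x ((tameSet a s i).indicator fun y => f y - lowerEnv s i y)| ≤ _
      have h23 : Integrable (fun y => g₂ y + g₃ y) P := hg₂i.add hg₃i
      rw [hdec, empDev_add n x hli h23, empDev_add n x hg₂i hg₃i]
      exact (abs_add_le _ _).trans (add_le_add_right (abs_add_le _ _) _)
    linarith [hlink i hi]
  have hsum : ∀ q ≤ Q, R 0 ≤ ∑ i ∈ Finset.range q, (2 * t i + ε (i + 1) ^ 2 / a (i + 1)) + R q := by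
    intro q
    induction q with
    | zero => intro _; simp
    | succ q ih =>
      intro hq
      rw [Finset.sum_range_succ]
      linarith [ih (by omega), hstep q (by omega)]
  have hlast : R Q ≤ t Q + ε Q := by
    obtain ⟨h1, h2, -⟩ := isChainMember_chainWidth hS hs hf ha Q
    refine (abs_empDev_le_of_le n x (hrem _ _ (hA Q)) (integrable_of_abs_le h1 h2) (fun y => ?_)
      fun y => ?_).trans (add_le_add hwidth (integral_chainWidth_le hS hs hf ha hε))
    · exact indicator_nonneg (fun y _ => sub_nonneg.2 (hlo _ y)) y
    · exact indicator_le_indicator (sub_le_sub_right (hup _ y) _)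
  have hfirst : |empDev P n x f| ≤ |empDev P n x (lowerEnv s 0)| + R 0 := by
    -- Bracket ends lie in `[-1, 1]`, so `2 ≤ a 0` means that nothing is truncated at level 0.
    have huniv : ∀ y, y ∈ tameSet a s 0 := fun y j hj => by
      obtain rfl : j = 0 := by omega
      have h1 := abs_le.1 (hb₁ 0 y)
      have h2 := abs_le.1 (hb₂ 0 y)
      linarith
    have hdec : f = fun y => lowerEnv s 0 y
        + (tameSet a s 0).indicator (fun y => f y - lowerEnv s 0 y) y := by
      funext y
      simp [huniv y]
    conv_lhs => rw [hdec]
    rw [empDev_add n x (integrable_of_abs_le (measurable_lowerEnv hm₁ 0) (hb₁ 0))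
      (hrem _ _ (hA 0))]
    exact abs_add_le _ _
  linarith [hsum Q le_rfl]

end Members

/-- Finite classes that contain all the steps of the chains through a sequence of bracket
covers. -/
lemma exists_chain_classes {F : Set (𝓧 → ℝ)} {ε a : ℕ → ℝ}
    {S : ℕ → Finset ((𝓧 → ℝ) × (𝓧 → ℝ))} (hS : ∀ i, IsBracketCover P F (ε i) (S i))
    (hFm : ∀ f ∈ F, Measurable f) (hF1 : ∀ f ∈ F, ∀ x, |f x| ≤ 1)
    (hFε : ∀ f ∈ F, ∫ x, f x ^ 2 ∂P ≤ ε 0 ^ 2) (ha : ∀ i, 0 < a i) (ha0 : 2 ≤ a 0) :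
    ∃ G : ℕ → Finset (𝓧 → ℝ),
      (∀ i, (G i).card ≤ 4 * ∏ j ∈ Finset.range (i + 2), (S j).card) ∧
      (∀ i, ∀ g ∈ G i, IsChainMember P (a i) (4 * ε i ^ 2) g) ∧
      ∀ (n Q : ℕ) (x : ℕ → 𝓧) (t : ℕ → ℝ), 0 < ε Q →
        (∀ i ≤ Q, ∀ g ∈ G i, |empDev P n x g| ≤ t i) →
        ∀ f ∈ F, |empDev P n x f| ≤ t 0
          + ∑ i ∈ Finset.range Q, (2 * t i + ε (i + 1) ^ 2 / a (i + 1)) + (t Q + ε Q) := by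
  classical
  let T : (i : ℕ) → Finset (Fin (i + 2) → (𝓧 → ℝ) × (𝓧 → ℝ)) := fun i =>
    Fintype.piFinset fun j => S j
  -- The padding `(0, 0)` is never read: level `i` uses indices up to `i + 1` only.
  let ext : (i : ℕ) → (Fin (i + 2) → (𝓧 → ℝ) × (𝓧 → ℝ)) → ℕ → (𝓧 → ℝ) × (𝓧 → ℝ) := fun i w j =>
    if h : j < i + 2 then w ⟨j, h⟩ else (0, 0)
  have hext : ∀ (s : ℕ → (𝓧 → ℝ) × (𝓧 → ℝ)) i, ∀ j ≤ i + 1, ext i (fun j => s j) j = s j := by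
    intro s i j hj
    simp [ext, show j < i + 2 by omega]
  have hT : ∀ (s : ℕ → (𝓧 → ℝ) × (𝓧 → ℝ)), (∀ i, s i ∈ S i) → ∀ i,
      (fun j : Fin (i + 2) => s j) ∈ T i := fun s hs i =>
    Fintype.mem_piFinset.2 fun j => hs j
  -- Arbitrary tuples of brackets need not contain a common function and may violate the Bernstein
  -- bounds. The filter discards the offending functions; those arising from some `f ∈ F` survive.
  let G : ℕ → Finset (𝓧 → ℝ) := fun i =>
    (((T i).image (fun w => lowerEnv (ext i w) 0) ∪ (T i).image (fun w => chainLink a (ext i w) i))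
      ∪ ((T i).image (fun w => chainExcess a (ext i w) i)
        ∪ (T i).image (fun w => chainWidth a (ext i w) i))).filter
      (IsChainMember P (a i) (4 * ε i ^ 2))
  refine ⟨G, fun i => ?_, fun i g hg => (Finset.mem_filter.1 hg).2, ?_⟩
  · have hcard : (T i).card = ∏ j ∈ Finset.range (i + 2), (S j).card := by
      rw [Fintype.card_piFinset, Finset.prod_range fun j => (S j).card]
    rw [← hcard]
    refine (Finset.card_filter_le _ _).trans ((Finset.card_union_le _ _).trans ?_)
    have h1 := Finset.card_union_le ((T i).image (fun w => lowerEnv (ext i w) 0))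
      ((T i).image (fun w => chainLink a (ext i w) i))
    have h2 := Finset.card_union_le ((T i).image (fun w => chainExcess a (ext i w) i))
      ((T i).image (fun w => chainWidth a (ext i w) i))
    have h3 : ∀ Φ : (Fin (i + 2) → (𝓧 → ℝ) × (𝓧 → ℝ)) → 𝓧 → ℝ,
      ((T i).image Φ).card ≤ (T i).card := fun Φ => Finset.card_image_le
    have h4 := h3 fun w => lowerEnv (ext i w) 0
    have h5 := h3 fun w => chainLink a (ext i w) i
    have h6 := h3 fun w => chainExcess a (ext i w) i
    have h7 := h3 fun w => chainWidth a (ext i w) i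
    omega
  · intro n Q x t hε hG f hf
    choose s hs hsf using fun i => (hS i).exists_mem f hf
    refine abs_empDev_le_of_chain hS hs hsf (hFm f hf) (hF1 f hf) ha ha0 hε
      (hG 0 (Nat.zero_le _) _ ?_) (fun i hi => hG i hi.le _ ?_) (fun i hi => hG i hi.le _ ?_)
      (hG Q le_rfl _ ?_)
    · refine Finset.mem_filter.2 ⟨?_, isChainMember_lowerEnv_zero hS hs hsf (hFm f hf) (hF1 f hf)
        (hFε f hf) ha0⟩
      refine Finset.mem_union_left _ (Finset.mem_union_left _ (Finset.mem_image.2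
        ⟨_, hT s hs 0, lowerEnv_congr fun j hj => hext s 0 j (by omega)⟩))
    · refine Finset.mem_filter.2 ⟨?_, isChainMember_chainLink hS hs hsf ha i⟩
      exact Finset.mem_union_left _ (Finset.mem_union_right _ (Finset.mem_image.2
        ⟨_, hT s hs i, chainLink_congr (hext s i)⟩))
    · refine Finset.mem_filter.2 ⟨?_, isChainMember_chainExcess hS hs hsf ha i⟩
      exact Finset.mem_union_right _ (Finset.mem_union_left _ (Finset.mem_image.2
        ⟨_, hT s hs i, chainExcess_congr (hext s i)⟩))
    · refine Finset.mem_filter.2 ⟨?_, isChainMember_chainWidth hS hs hsf ha Q⟩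
      exact Finset.mem_union_right _ (Finset.mem_union_right _ (Finset.mem_image.2
        ⟨_, hT s hs Q, chainWidth_congr (hext s Q)⟩))

end Chaining

/-! ### A maximal inequality for classes with small bracketing entropy -/

section Maximal

variable {𝓧 Ω : Type*} [MeasurableSpace 𝓧] [MeasurableSpace Ω]
  {μ : Measure Ω} [IsProbabilityMeasure μ] {P : Measure 𝓧} [IsProbabilityMeasure P]
  {X : ℕ → Ω → 𝓧}

lemma IsBracketCover.mono {P : Measure 𝓧} {F F' : Set (𝓧 → ℝ)} {ε ε' : ℝ}
    {S : Finset ((𝓧 → ℝ) × (𝓧 → ℝ))} (h : IsBracketCover P F ε S) (hF : F' ⊆ F) (hε0 : 0 ≤ ε)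
    (hε : ε ≤ ε') : IsBracketCover P F' ε' S where
  measurable_fst := h.measurable_fst
  measurable_snd := h.measurable_snd
  abs_fst_le := h.abs_fst_le
  abs_snd_le := h.abs_snd_le
  integral_le s hs := (h.integral_le s hs).trans (pow_le_pow_left₀ hε0 hε 2)
  exists_mem f hf := h.exists_mem f (hF hf)

/-- The supremum of the empirical process over a class of radius `δ` in `L₂(P)`. -/
lemma measure_exists_lt_abs_empDev_le_of_radius (hX : ∀ i, Measurable (X i))
    (hindep : iIndepFun X μ) (hlaw : ∀ i, Measure.map (X i) μ = P) {F : Set (𝓧 → ℝ)}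
    {S : ℕ → Finset ((𝓧 → ℝ) × (𝓧 → ℝ))} {n : ℕ} {v r δ C M : ℝ} (hn : 0 < n) (hv : 1 ≤ v)
    (hr : 0 < r) (hnr : n * r ^ 2 = v) (hδ : r ≤ δ) (hM : 1 ≤ M) (hκ : 1 ≤ M / 24 - 4 * C)
    (hC : 0 ≤ C) (hS : ∀ i, IsBracketCover P F (δ * (1 / 2) ^ i) (S i))
    (hcard : ∀ i, ((S i).card : ℝ) ≤ Real.exp (C * (v * 2 ^ i)))
    (hFm : ∀ f ∈ F, Measurable f) (hF1 : ∀ f ∈ F, ∀ x, |f x| ≤ 1)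
    (hFδ : ∀ f ∈ F, ∫ x, f x ^ 2 ∂P ≤ δ ^ 2) :
    μ {ω | ∃ f ∈ F, 14 * M * (δ * r) < |empDev P n (fun i => X i ω) f|}
      ≤ ENNReal.ofReal (16 * Real.exp (-((M / 24 - 4 * C) * v))) := by
  set κ := M / 24 - 4 * C with hκdef
  have hδ0 : 0 < δ := hr.trans_le hδ
  have hn' : (0 : ℝ) < n := Nat.cast_pos.2 hn
  -- The ratios satisfy `1/3 * 3/4 = (1/2)²`, so `a i * τ i` is a multiple of `ε i ^ 2` and
  -- Bernstein's variance and sup-norm terms balance. Moreover `(3/4)² ≥ 2 * (1/2)²` lets the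
  -- exponent keep pace with the entropy `v * 2 ^ i`, while `τ` remains summable.
  let ε : ℕ → ℝ := fun i => δ * (1 / 2) ^ i
  let a : ℕ → ℝ := fun i => 2 * (δ / r) * (1 / 3) ^ i
  let τ : ℕ → ℝ := fun i => δ * r * (3 / 4) ^ i
  have hε0 : ∀ i, 0 < ε i := fun i => by positivity
  have ha : ∀ i, 0 < a i := fun i => by positivity
  have hτ : ∀ i, 0 < τ i := fun i => by positivity
  have haτ : ∀ i, a i * τ i = 2 * ε i ^ 2 := fun i => by
    have h1 : ((1 : ℝ) / 3) ^ i * (3 / 4) ^ i = ((1 / 2) ^ i) ^ 2 := by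
      rw [← mul_pow, ← pow_mul, mul_comm i 2, pow_mul]; norm_num
    calc a i * τ i = 2 * (δ / r * r) * δ * ((1 / 3) ^ i * (3 / 4) ^ i) := by simp only [a, τ]; ring
      _ = _ := by rw [h1, div_mul_cancel₀ _ hr.ne']; simp only [ε]; ring
  have ha0 : 2 ≤ a 0 := by
    have : 1 ≤ δ / r := (one_le_div hr).2 hδ
    simp only [a, pow_zero]; linarith
  have hτε : ∀ i, v * 2 ^ i * ε i ^ 2 ≤ n * τ i ^ 2 := fun i => by
    have h1 : ((2 : ℝ)) ^ i * ((1 / 2) ^ i) ^ 2 ≤ ((3 / 4) ^ i) ^ 2 := by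
      rw [← pow_mul, ← pow_mul, mul_comm i 2, pow_mul, pow_mul, ← mul_pow]
      exact pow_le_pow_left₀ (by norm_num) (by norm_num) i
    calc v * 2 ^ i * ε i ^ 2 = v * δ ^ 2 * (2 ^ i * ((1 / 2) ^ i) ^ 2) := by simp only [ε]; ring
      _ ≤ v * δ ^ 2 * ((3 / 4) ^ i) ^ 2 := by gcongr
      _ = n * τ i ^ 2 := by rw [← hnr]; simp only [τ]; ring
  obtain ⟨G, hGcard, hG, hchain⟩ := exists_chain_classes hS hFm hF1
    (fun f hf => by simpa using hFδ f hf) ha ha0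
  -- The chain stops once `ε Q ≤ δ r`, so the final bias is of the target order.
  obtain ⟨Q, hQ⟩ := exists_pow_lt_of_lt_one hr (show (1 / 2 : ℝ) < 1 by norm_num)
  have hsub : {ω | ∃ f ∈ F, 14 * M * (δ * r) < |empDev P n (fun i => X i ω) f|}
      ⊆ ⋃ i ∈ Finset.range (Q + 1),
        {ω | ∃ g ∈ G i, M * τ i < |empDev P n (fun i => X i ω) g|} := by
    rintro ω ⟨f, hf, hlt⟩
    by_contra hcon
    simp only [mem_iUnion, Finset.mem_range, not_exists, mem_ofPred_eq, not_and, not_lt] at hcon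
    have h1 := hchain n Q (fun i => X i ω) (fun i => M * τ i) (hε0 Q)
      (fun i hi g hg => hcon i (by omega) g hg) f hf
    have h2 : ∀ i, 2 * (M * τ i) + ε (i + 1) ^ 2 / a (i + 1) ≤ 3 * M * τ i := fun i => by
      have h3 : ε (i + 1) ^ 2 / a (i + 1) = τ (i + 1) / 2 := by
        rw [div_eq_div_iff (ha _).ne' (by norm_num)]
        linarith [haτ (i + 1)]
      have h4 : τ (i + 1) = 3 / 4 * τ i := by simp only [τ]; ring
      have h5 : τ i ≤ M * τ i := le_mul_of_one_le_left (hτ i).le hM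
      rw [h3, h4]
      linarith [hτ i]
    -- In units of `δ r`, the chain costs at most `M + 12M(1 - (3/4)^Q) + M(3/4)^Q + 1 ≤ 14M`.
    have h3 : ∀ q, ∑ i ∈ Finset.range q, 3 * M * τ i
        = 12 * M * (δ * r) * (1 - (3 / 4) ^ q) := fun q => by
      induction q with
      | zero => simp
      | succ q ih => rw [Finset.sum_range_succ, ih]; simp only [τ]; ring
    have h4 : ε Q ≤ δ * r := mul_le_mul_of_nonneg_left hQ.le hδ0.le
    have h5 := Finset.sum_le_sum fun i (_ : i ∈ Finset.range Q) => h2 i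
    rw [h3 Q] at h5
    have h6 : τ 0 = δ * r := by simp [τ]
    have h7 : τ Q = δ * r * (3 / 4) ^ Q := rfl
    have h8 : 0 < δ * r := by positivity
    have h9 : (0 : ℝ) < (3 / 4) ^ Q := by positivity
    have h10 : δ * r ≤ M * (δ * r) := le_mul_of_one_le_left h8.le hM
    have h11 : 0 < M * (δ * r) * (3 / 4) ^ Q := by positivity
    simp only [h6, h7] at h1
    nlinarith
  refine (measure_mono hsub).trans ((measure_biUnion_finset_le _ _).trans ?_)
  have hlevel : ∀ i, μ {ω | ∃ g ∈ G i, M * τ i < |empDev P n (fun i => X i ω) g|}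
      ≤ ENNReal.ofReal (8 * Real.exp (-(κ * v)) * Real.exp (-(κ * v)) ^ i) := by
    intro i
    have hN : ((G i).card : ℝ) ≤ 4 * Real.exp (4 * C * (v * 2 ^ i)) := by
      have h1 : ((G i).card : ℝ) ≤ 4 * ∏ j ∈ Finset.range (i + 2), ((S j).card : ℝ) := by
        exact_mod_cast hGcard i
      refine h1.trans (mul_le_mul_of_nonneg_left ?_ (by norm_num))
      refine (Finset.prod_le_prod (fun j _ => Nat.cast_nonneg _) fun j _ => hcard j).trans ?_
      rw [← Real.exp_sum, ← Finset.mul_sum, ← Finset.mul_sum]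
      refine Real.exp_le_exp.2 ?_
      have h2 : ∑ j ∈ Finset.range (i + 2), (2 : ℝ) ^ j ≤ 4 * 2 ^ i := by
        rw [geom_sum_eq (by norm_num)]
        norm_num [pow_add]
        linarith
      calc C * (v * ∑ j ∈ Finset.range (i + 2), (2 : ℝ) ^ j) ≤ C * (v * (4 * 2 ^ i)) := by gcongr
        _ = _ := by ring
    refine (measure_exists_lt_abs_empDev_le hX hindep hlaw hn (ha i) (by have := hτ i; positivity)
      hN fun g hg => hG i g hg).trans (ENNReal.ofReal_le_ofReal ?_)
    have hexp : M / 24 * (v * 2 ^ i)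
        ≤ n * (M * τ i) ^ 2 / (4 * (4 * ε i ^ 2 + a i * (M * τ i))) := by
      have h1 : a i * (M * τ i) = 2 * M * ε i ^ 2 := by linear_combination M * haτ i
      have h2 : 0 < ε i ^ 2 := pow_pos (hε0 i) 2
      rw [h1, le_div_iff₀ (by positivity)]
      have h3 := hτε i
      have h4 : 0 < v * 2 ^ i := by positivity
      calc M / 24 * (v * 2 ^ i) * (4 * (4 * ε i ^ 2 + 2 * M * ε i ^ 2))
          ≤ M / 24 * (v * 2 ^ i) * (4 * (6 * M * ε i ^ 2)) := by
            gcongr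
            nlinarith
        _ = M ^ 2 * (v * 2 ^ i * ε i ^ 2) := by ring
        _ ≤ M ^ 2 * (n * τ i ^ 2) := by gcongr
        _ = _ := by ring
    -- This weakens the doubly exponential tail over levels to a geometric one.
    have hpow : (i : ℝ) + 1 ≤ 2 ^ i := by
      exact_mod_cast (Nat.lt_two_pow_self (n := i))
    calc 4 * Real.exp (4 * C * (v * 2 ^ i)) * (2 * Real.exp
          (-(n * (M * τ i) ^ 2 / (4 * (4 * ε i ^ 2 + a i * (M * τ i))))))
        ≤ 4 * Real.exp (4 * C * (v * 2 ^ i)) * (2 * Real.exp (-(M / 24 * (v * 2 ^ i)))) := by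
          gcongr
      _ = 8 * Real.exp (-(κ * v) * 2 ^ i) := by
          rw [show (-(κ * v) * 2 ^ i : ℝ) = 4 * C * (v * 2 ^ i) + -(M / 24 * (v * 2 ^ i)) by
            rw [hκdef]; ring, Real.exp_add]
          ring
      _ ≤ 8 * Real.exp (-(κ * v) * (i + 1)) := by
          have : 0 ≤ κ * v := by positivity
          gcongr 8 * Real.exp ?_
          nlinarith
      _ = _ := by
          rw [← Real.exp_nat_mul, mul_assoc, ← Real.exp_add]
          congr 2; ring
  refine (Finset.sum_le_sum fun i _ => hlevel i).trans ?_
  rw [← ENNReal.ofReal_sum_of_nonneg fun i _ => by positivity]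
  refine ENNReal.ofReal_le_ofReal ?_
  rw [← Finset.mul_sum]
  set w := Real.exp (-(κ * v)) with hw
  have hw0 : 0 < w := Real.exp_pos _
  have hw1 : w ≤ 1 / 2 := by
    have h1 : 1 ≤ κ * v := by nlinarith
    have h2 : w ≤ Real.exp (-1) := Real.exp_le_exp.2 (by linarith)
    have h3 := Real.exp_neg_one_lt_d9
    linarith
  have hgeom : ∑ i ∈ Finset.range (Q + 1), w ^ i ≤ 2 := by
    refine (Finset.sum_le_sum fun i _ => pow_le_pow_left₀ hw0.le hw1 i).trans ?_
    exact sum_geometric_two_le _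
  nlinarith

/-- The empirical process indexed by a class whose bracketing entropy is of order `ε^(-1/k)`:
outside an event of small probability, uniformly in the class,
`|ℙ_n f - P f| ≲ r (r + ‖f‖₂)` with `r = n^(-k/(2k+1))`. -/
lemma measure_exists_lt_abs_empDev_le_of_entropy (hX : ∀ i, Measurable (X i))
    (hindep : iIndepFun X μ) (hlaw : ∀ i, Measure.map (X i) μ = P) {F : Set (𝓧 → ℝ)}
    {k n : ℕ} (hk : 1 ≤ k) (hn : 0 < n) {v C M : ℝ} (hv : 1 ≤ v) (hvn : v ^ (2 * k + 1) = n)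
    (hM : 1 ≤ M) (hκ : 1 ≤ M / 24 - 4 * C) (hC : 0 ≤ C)
    (hcov : ∀ y : ℝ, 1 ≤ y → ∃ S, IsBracketCover P F (1 / y ^ k) S ∧
      (S.card : ℝ) ≤ Real.exp (C * y))
    (hFm : ∀ f ∈ F, Measurable f) (hF1 : ∀ f ∈ F, ∀ x, |f x| ≤ 1) :
    μ {ω | ∃ f ∈ F, ∃ ρ : ℝ, 0 ≤ ρ ∧ ∫ x, f x ^ 2 ∂P ≤ ρ ^ 2 ∧
        28 * M * (1 / v ^ k * (1 / v ^ k + ρ)) < |empDev P n (fun i => X i ω) f|}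
      ≤ ENNReal.ofReal (16 * k.factorial * Real.exp (-(M / 24 - 4 * C - 1))) := by
  set κ := M / 24 - 4 * C with hκdef
  have hv0 : 0 < v := by linarith
  set r := 1 / v ^ k with hr
  have hr0 : 0 < r := by positivity
  have hvk : 1 ≤ v ^ k := one_le_pow₀ hv
  have hr1 : r ≤ 1 := by rw [hr, div_le_one (by positivity)]; exact hvk
  have hnr : n * r ^ 2 = v := by
    rw [hr, ← hvn]; field_simp; ring
  let δ : ℕ → ℝ := fun m => (1 / 2) ^ m
  have hsub : {ω | ∃ f ∈ F, ∃ ρ : ℝ, 0 ≤ ρ ∧ ∫ x, f x ^ 2 ∂P ≤ ρ ^ 2 ∧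
        28 * M * (r * (r + ρ)) < |empDev P n (fun i => X i ω) f|}
      ⊆ ⋃ m ∈ Finset.range ⌊v ^ k⌋₊, {ω | r ≤ δ m ∧ ∃ f ∈ {f ∈ F | ∫ x, f x ^ 2 ∂P ≤ δ m ^ 2},
          14 * M * (δ m * r) < |empDev P n (fun i => X i ω) f|} := by
    rintro ω ⟨f, hf, ρ, hρ0, hρ, hlt⟩
    -- Radii are capped at 1 because `|f| ≤ 1`, and floored at `r`, below which the bound does not
    -- improve; a dyadic `δ m` is then chosen within a factor 2 above `y`.
    set y := max r (min ρ 1) with hy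
    have hy0 : 0 < y := hr0.trans_le (le_max_left _ _)
    have hy1 : y ≤ 1 := max_le hr1 (min_le_right _ _)
    obtain ⟨m, hm1, hm2⟩ := exists_nat_pow_near_of_lt_one hy0 hy1
      (show (0 : ℝ) < 1 / 2 by norm_num) (by norm_num)
    have hrδ : r ≤ δ m := (le_max_left _ _).trans hm2
    have hfsq : ∫ x, f x ^ 2 ∂P ≤ (min ρ 1) ^ 2 := by
      rcases min_cases ρ 1 with h | h
      · rw [h.1]; exact hρ
      · rw [h.1]
        have : ∫ x, f x ^ 2 ∂P ≤ ∫ _, (1 : ℝ) ∂P :=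
          integral_mono (integrable_sq_of_abs_le (hFm f hf) (hF1 f hf)) (integrable_const _)
            fun x => by simpa using (sq_le_one_iff_abs_le_one _).2 (hF1 f hf x)
        simpa using this
    have hyρ : y ≤ r + ρ := max_le (by linarith) ((min_le_left _ _).trans (by linarith))
    have hδy : δ m ≤ 2 * (r + ρ) := by
      rw [pow_succ] at hm1
      change (1 / 2 : ℝ) ^ m ≤ _
      linarith
    simp only [mem_iUnion, mem_ofPred_eq, Finset.mem_range]
    refine ⟨m, ?_, hrδ, f, ⟨hf, hfsq.trans
      (pow_le_pow_left₀ (le_min hρ0 zero_le_one) ((le_max_right _ _).trans hm2) 2)⟩, ?_⟩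
    · have h1 : ((2 ^ m : ℕ) : ℝ) ≤ v ^ k := by
        have h2 : δ m = 1 / 2 ^ m := by simp [δ]
        rw [h2, hr, one_div_le_one_div (by positivity) (by positivity)] at hrδ
        exact_mod_cast hrδ
      -- The crude count `m < 2^m ≤ v^k` of shells suffices, since `v^k ≤ k! exp v` costs only 1 in
      -- the exponent.
      exact Nat.lt_two_pow_self.trans_le (Nat.le_floor h1)
    · refine lt_of_le_of_lt ?_ hlt
      have h1 : δ m * r ≤ 2 * (r + ρ) * r := mul_le_mul_of_nonneg_right hδy hr0.le
      nlinarith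
  refine (measure_mono hsub).trans ((measure_biUnion_finset_le _ _).trans ?_)
  have hpeel : ∀ m, μ {ω | r ≤ δ m ∧ ∃ f ∈ {f ∈ F | ∫ x, f x ^ 2 ∂P ≤ δ m ^ 2},
      14 * M * (δ m * r) < |empDev P n (fun i => X i ω) f|}
      ≤ ENNReal.ofReal (16 * Real.exp (-(κ * v))) := by
    intro m
    by_cases hrδ : r ≤ δ m
    · simp only [hrδ, true_and]
      -- At scale `v * 2 ^ i` the log-cardinality is `C v 2^i` and the width is `r (2^i)^(-k)`, at
      -- most `δ m / 2^i` because `k ≥ 1`.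
      choose S hS hcard using fun i : ℕ => hcov (v * 2 ^ i)
        (one_le_mul_of_one_le_of_one_le hv (one_le_pow₀ (by norm_num)))
      refine measure_exists_lt_abs_empDev_le_of_radius hX hindep hlaw hn hv hr0 hnr hrδ hM hκ hC
        (S := S) (fun i => (hS i).mono (fun f hf => hf.1) (by positivity) ?_) hcard
        (fun f hf => hFm f hf.1) (fun f hf => hF1 f hf.1) (fun f hf => hf.2)
      have h1 : (2 : ℝ) ^ i ≤ (2 ^ i) ^ k :=
        le_self_pow₀ (one_le_pow₀ (by norm_num)) (by omega)
      calc 1 / (v * 2 ^ i) ^ k = r * (1 / (2 ^ i) ^ k) := by rw [hr, mul_pow]; field_simp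
        _ ≤ r * (1 / 2 ^ i) := by gcongr
        _ ≤ δ m * (1 / 2) ^ i := by rw [one_div_pow]; gcongr
    · simp [hrδ]
  refine (Finset.sum_le_card_nsmul _ _ _ fun m _ => hpeel m).trans ?_
  rw [nsmul_eq_mul, Finset.card_range, ← ENNReal.ofReal_natCast,
    ← ENNReal.ofReal_mul (Nat.cast_nonneg _)]
  refine ENNReal.ofReal_le_ofReal ?_
  have h1 : (⌊v ^ k⌋₊ : ℝ) ≤ k.factorial * Real.exp v := by
    refine (Nat.floor_le (by positivity)).trans ?_
    have := Real.pow_div_factorial_le_exp v hv0.le k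
    rwa [div_le_iff₀' (by positivity)] at this
  calc (⌊v ^ k⌋₊ : ℝ) * (16 * Real.exp (-(κ * v)))
      ≤ k.factorial * Real.exp v * (16 * Real.exp (-(κ * v))) := by gcongr
    _ = 16 * k.factorial * Real.exp (-((κ - 1) * v)) := by
        rw [show -((κ - 1) * v) = v + -(κ * v) by ring, Real.exp_add]; ring
    _ ≤ _ := by
        gcongr
        nlinarith

end Maximal

/-! ### Bracket covers from entropy bounds -/

section Entropy

variable {𝓧 : Type*} [MeasurableSpace 𝓧] {P : Measure 𝓧}

lemma integral_sq_le_of_eLpNorm_le {f : 𝓧 → ℝ} {ε : ℝ} (hf : MemLp f 2 P) (hε : 0 ≤ ε)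
    (h : eLpNorm f 2 P ≤ ENNReal.ofReal ε) : ∫ x, f x ^ 2 ∂P ≤ ε ^ 2 := by
  rw [hf.eLpNorm_eq_integral_rpow_norm (by norm_num) (by norm_num),
    ENNReal.ofReal_le_ofReal_iff hε] at h
  simp only [ENNReal.toReal_ofNat, Real.rpow_two, Real.norm_eq_abs, sq_abs] at h
  have h0 : 0 ≤ ∫ x, f x ^ 2 ∂P := integral_nonneg fun x => sq_nonneg _
  have h1 := pow_le_pow_left₀ (Real.rpow_nonneg h0 _) h 2
  rwa [← Real.rpow_natCast, ← Real.rpow_mul h0, Nat.cast_ofNat, inv_mul_cancel₀ (by norm_num),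
    Real.rpow_one] at h1

lemma exists_coveredByBrackets {𝓐 : Set (𝓧 → ℝ)} {δ x : ℝ}
    (h : bracketingEntropy P 𝓐 δ ≤ (x : EReal)) :
    ∃ N : ℕ, CoveredByBrackets P 𝓐 δ N ∧ (N : ℝ) ≤ Real.exp x := by
  have h1 : ((bracketingNumber P 𝓐 δ : ℕ∞) : ℝ≥0∞) ≤ ENNReal.ofReal (Real.exp x) := by
    rw [← ENNReal.log_le_log_iff, ENNReal.log_ofReal, if_neg (not_le.2 (Real.exp_pos x)),
      Real.log_exp]
    exact h
  have h2 : bracketingNumber P 𝓐 δ ≠ ⊤ := by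
    intro htop
    rw [htop] at h1
    simp at h1
  obtain ⟨N, hN⟩ := ENat.ne_top_iff_exists.1 h2
  -- Strictness extracts an actual cover from the infimum.
  have h3 : bracketingNumber P 𝓐 δ < ((N + 1 : ℕ) : ℕ∞) := by
    rw [← hN]; exact_mod_cast Nat.lt_succ_self N
  obtain ⟨N', h4⟩ := iInf_lt_iff.1 h3
  obtain ⟨hcov, h5⟩ := iInf_lt_iff.1 h4
  refine ⟨N', hcov, ?_⟩
  have h6 : N' ≤ N := Nat.lt_succ_iff.1 (by exact_mod_cast h5)
  rw [← hN] at h1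
  have h7 : ENNReal.ofReal N ≤ ENNReal.ofReal (Real.exp x) := by
    rw [ENNReal.ofReal_natCast]; exact_mod_cast h1
  rw [ENNReal.ofReal_le_ofReal_iff (Real.exp_pos x).le] at h7
  exact (Nat.cast_le.2 h6).trans h7

/-- A bracket for functions with values in `[-1, 1]` can be taken measurable and with values in
`[-1, 1]`. -/
lemma exists_measurable_bracket {l u : 𝓧 → ℝ} (hl : AEStronglyMeasurable l P)
    (hu : AEStronglyMeasurable u P) :
    ∃ l' u' : 𝓧 → ℝ, Measurable l' ∧ Measurable u' ∧ (∀ x, |l' x| ≤ 1) ∧ (∀ x, |u' x| ≤ 1) ∧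
      eLpNorm (fun x => u' x - l' x) 2 P ≤ eLpNorm (fun x => u x - l x) 2 P ∧
      ∀ f : 𝓧 → ℝ, (∀ x, |f x| ≤ 1) → (∀ x, l x ≤ f x ∧ f x ≤ u x) →
        ∀ x, l' x ≤ f x ∧ f x ≤ u' x := by
  classical
  have hae : ∀ᵐ x ∂P, l x = hl.mk l x ∧ u x = hu.mk u x := hl.ae_eq_mk.and hu.ae_eq_mk
  -- On this null set the bracket becomes `[-1, 1]`, so the inclusion stays pointwise although
  -- measurable versions replace `l` and `u` elsewhere.
  set N := toMeasurable P {x | ¬ (l x = hl.mk l x ∧ u x = hu.mk u x)} with hN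
  have hNm : MeasurableSet N := measurableSet_toMeasurable _ _
  have hN0 : P N = 0 := by rw [hN, measure_toMeasurable]; exact hae
  have hNc : ∀ x, x ∉ N → l x = hl.mk l x ∧ u x = hu.mk u x := fun x hx => by
    by_contra hcon
    exact hx (subset_toMeasurable _ _ hcon)
  have hclip : ∀ t : ℝ, |max (-1) (min 1 t)| ≤ 1 := fun t =>
    abs_le.2 ⟨le_max_left _ _, max_le (by norm_num) (min_le_left _ _)⟩
  refine ⟨fun x => if x ∈ N then -1 else max (-1) (min 1 (hl.mk l x)),
    fun x => if x ∈ N then 1 else max (-1) (min 1 (hu.mk u x)),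
    Measurable.ite hNm measurable_const
      (measurable_const.max (measurable_const.min hl.stronglyMeasurable_mk.measurable)),
    Measurable.ite hNm measurable_const
      (measurable_const.max (measurable_const.min hu.stronglyMeasurable_mk.measurable)),
    fun x => ?_, fun x => ?_, ?_, fun f hf1 hf x => ?_⟩
  · by_cases hx : x ∈ N
    · simp [hx]
    · simpa [hx] using hclip _
  · by_cases hx : x ∈ N
    · simp [hx]
    · simpa [hx] using hclip _
  · refine eLpNorm_mono_ae ?_
    have hNae : ∀ᵐ x ∂P, x ∉ N := measure_eq_zero_iff_ae_notMem.1 hN0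
    filter_upwards [hNae] with x hx
    obtain ⟨h1, h2⟩ := hNc x hx
    simp only [hx, if_false, ← h1, ← h2, Real.norm_eq_abs]
    refine (abs_max_sub_max_le_max _ _ _ _).trans ?_
    rw [sub_self, abs_zero]
    refine max_le (abs_nonneg _) ((abs_min_sub_min_le_max _ _ _ _).trans ?_)
    rw [sub_self, abs_zero]
    exact max_le (abs_nonneg _) le_rfl
  · have h1 := abs_le.1 (hf1 x)
    by_cases hx : x ∈ N
    · simpa [hx] using h1
    · obtain ⟨h2, h3⟩ := hNc x hx
      simp only [hx, if_false, ← h2, ← h3]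
      exact ⟨max_le h1.1 ((min_le_right _ _).trans (hf x).1),
        le_max_of_le_right (le_min h1.2 (hf x).2)⟩

/-- A class that is covered by finitely many brackets has a square integrable envelope. -/
lemma CoveredByBrackets.exists_envelope {𝓐 : Set (𝓧 → ℝ)} {δ : ℝ} {N : ℕ}
    (h : CoveredByBrackets P 𝓐 δ N) :
    ∃ E : 𝓧 → ℝ, MemLp E 2 P ∧ ∀ f ∈ 𝓐, ∀ x, |f x| ≤ E x := by
  obtain ⟨l, u, h1, h2⟩ := h
  refine ⟨fun x => ∑ j, (|l j x| + |u j x|), memLp_finsetSum _ fun j _ =>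
    (h1 j).1.norm.add (h1 j).2.1.norm, fun f hf x => ?_⟩
  obtain ⟨j, hj⟩ := h2 f hf
  refine le_trans ?_ (Finset.single_le_sum (f := fun j => |l j x| + |u j x|)
    (fun i _ => by positivity) (Finset.mem_univ j))
  have h3 := neg_abs_le (l j x)
  have h4 := le_abs_self (u j x)
  have h5 := abs_nonneg (l j x)
  have h6 := abs_nonneg (u j x)
  rw [abs_le]
  constructor <;> linarith [(hj x).1, (hj x).2]

/-- Bracket covers for a bounded class of combinations `c (f - s g)` of members of a class with
known entropy. -/
lemma exists_isBracketCover_of_entropy {k : ℕ} (hk : 1 ≤ k) {𝓐 F : Set (𝓧 → ℝ)} {c L : ℝ}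
    (hc0 : 0 ≤ c) (hc1 : c ≤ 1) (hL : 0 ≤ L)
    (hentropy : ∃ C : ℝ, ∀ ε : ℝ, 0 < ε →
      bracketingEntropy P 𝓐 ε ≤ ((C * ε ^ (-(1 / (k : ℝ))) : ℝ) : EReal))
    (hF1 : ∀ f ∈ F, ∀ x, |f x| ≤ 1)
    (hF : ∀ f ∈ F, ∃ g ∈ 𝓐, ∃ h ∈ 𝓐, ∃ s, 0 ≤ s ∧ s ≤ L ∧ f = fun x => c * (g x - s * h x))
    [IsProbabilityMeasure P] :
    ∃ C : ℝ, 0 ≤ C ∧ ∀ y : ℝ, 1 ≤ y → ∃ S, IsBracketCover P F (1 / y ^ k) S ∧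
      (S.card : ℝ) ≤ Real.exp (C * y) := by
  classical
  obtain ⟨C, hC⟩ := hentropy
  obtain ⟨N₁, hN₁, -⟩ := exists_coveredByBrackets (hC 1 one_pos)
  obtain ⟨E, hE, hEle⟩ := hN₁.exists_envelope
  set K := (eLpNorm E 2 P).toReal with hK
  have hK0 : 0 ≤ K := ENNReal.toReal_nonneg
  have hEK : eLpNorm E 2 P = ENNReal.ofReal K := (ENNReal.ofReal_toReal hE.2.ne).symm
  -- Half of the width `1 / y^k` is spent on the brackets of `g` and `s h` with `s ≤ L`, the other
  -- half on discretizing `s` with mesh `ρ`, whose error is controlled by the envelope `E`. Using `K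
  -- + 1` avoids division by zero.
  set D := 2 * (1 + L) with hD
  have hD0 : 0 < D := by positivity
  set A := (4 * L * (K + 1) + 1) * k.factorial with hA
  have hA1 : 1 ≤ A := by
    have h1 : (1 : ℝ) ≤ k.factorial := by exact_mod_cast Nat.factorial_pos k
    have h2 : 0 ≤ 4 * L * (K + 1) := by positivity
    exact one_le_mul_of_one_le_of_one_le (by linarith) h1
  have hkR : (0 : ℝ) < k := by exact_mod_cast hk
  refine ⟨2 * |C| * D ^ (1 / (k : ℝ)) + Real.log A + 1,
    by have := Real.log_nonneg hA1; positivity, fun y hy => ?_⟩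
  have hy0 : 0 < y := by linarith
  have hyk : 0 < y ^ k := by positivity
  obtain ⟨N, ⟨l, u, hlu, hcov⟩, hN⟩ :=
    exists_coveredByBrackets (hC (1 / (D * y ^ k)) (by positivity))
  set ρ := 1 / (4 * (K + 1) * y ^ k) with hρ
  have hρ0 : 0 < ρ := by positivity
  let T := Finset.univ ×ˢ Finset.univ ×ˢ Finset.range (⌊L / ρ⌋₊ + 1) |>.filter
    fun q : Fin N × Fin N × ℕ => ρ * q.2.2 ≤ L
  let lo : Fin N × Fin N × ℕ → 𝓧 → ℝ := fun q x =>
    c * (l q.1 x - (ρ * q.2.2) * u q.2.1 x - ρ * E x)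
  let hi : Fin N × Fin N × ℕ → 𝓧 → ℝ := fun q x =>
    c * (u q.1 x - (ρ * q.2.2) * l q.2.1 x + ρ * E x)
  have hlo : ∀ q, MemLp (lo q) 2 P := fun q =>
    (((hlu q.1).1.sub ((hlu q.2.1).2.1.const_mul _)).sub (hE.const_mul ρ)).const_mul c
  have hhi : ∀ q, MemLp (hi q) 2 P := fun q =>
    (((hlu q.1).2.1.sub ((hlu q.2.1).1.const_mul _)).add (hE.const_mul ρ)).const_mul c
  have hwidth : ∀ q ∈ T, eLpNorm (fun x => hi q x - lo q x) 2 P ≤ ENNReal.ofReal (1 / y ^ k) := by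
    intro q hq
    have hqL : ρ * q.2.2 ≤ L := (Finset.mem_filter.1 hq).2
    have hq0 : 0 ≤ ρ * q.2.2 := by positivity
    have hw₁ : MemLp (fun x => u q.1 x - l q.1 x) 2 P := (hlu q.1).2.1.sub (hlu q.1).1
    have hw₂ : MemLp (fun x => u q.2.1 x - l q.2.1 x) 2 P := (hlu q.2.1).2.1.sub (hlu q.2.1).1
    have heq : (fun x => hi q x - lo q x) = c • ((fun x => u q.1 x - l q.1 x)
        + ((ρ * q.2.2) • (fun x => u q.2.1 x - l q.2.1 x) + (2 * ρ) • E)) := by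
      funext x
      simp only [hi, lo, Pi.smul_apply, Pi.add_apply, smul_eq_mul]
      ring
    have hnorm : ∀ (z : ℝ) (g : 𝓧 → ℝ), 0 ≤ z →
        eLpNorm (z • g) 2 P = ENNReal.ofReal z * eLpNorm g 2 P := fun z g hz => by
      rw [eLpNorm_const_smul, Real.enorm_eq_ofReal hz]
    rw [heq, hnorm _ _ hc0]
    calc ENNReal.ofReal c * eLpNorm ((fun x => u q.1 x - l q.1 x)
          + ((ρ * q.2.2) • (fun x => u q.2.1 x - l q.2.1 x) + (2 * ρ) • E)) 2 P
        ≤ 1 * (eLpNorm (fun x => u q.1 x - l q.1 x) 2 P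
          + (ENNReal.ofReal (ρ * q.2.2) * eLpNorm (fun x => u q.2.1 x - l q.2.1 x) 2 P
            + ENNReal.ofReal (2 * ρ) * eLpNorm E 2 P)) := by
          refine mul_le_mul' (ENNReal.ofReal_le_one.2 hc1) ?_
          refine (eLpNorm_add_le hw₁.1 ((hw₂.1.const_smul _).add (hE.1.const_smul _))
            (by norm_num)).trans (add_le_add_right ?_ _)
          refine (eLpNorm_add_le (hw₂.1.const_smul _) (hE.1.const_smul _) (by norm_num)).trans ?_
          rw [hnorm _ _ hq0, hnorm _ _ (by positivity)]
      _ ≤ ENNReal.ofReal (1 / (D * y ^ k)) + (ENNReal.ofReal L * ENNReal.ofReal (1 / (D * y ^ k))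
          + ENNReal.ofReal (2 * ρ) * ENNReal.ofReal K) := by
          rw [one_mul, hEK]
          gcongr
          · exact (hlu q.1).2.2
          · exact (hlu q.2.1).2.2
      _ = ENNReal.ofReal (1 / (D * y ^ k) + (L * (1 / (D * y ^ k)) + 2 * ρ * K)) := by
          rw [ENNReal.ofReal_add (by positivity) (by positivity),
            ENNReal.ofReal_add (by positivity) (by positivity), ENNReal.ofReal_mul hL,
            ENNReal.ofReal_mul (p := 2 * ρ) (by positivity)]
      _ ≤ _ := by
          refine ENNReal.ofReal_le_ofReal ?_
          have h1 : 1 / (D * y ^ k) + L * (1 / (D * y ^ k)) = 1 / 2 * (1 / y ^ k) := by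
            rw [hD]; field_simp
          have h2 : 2 * ρ * K ≤ 1 / 2 * (1 / y ^ k) := by
            rw [hρ, show 2 * (1 / (4 * (K + 1) * y ^ k)) * K
              = 1 / 2 * (1 / y ^ k) * (K / (K + 1)) by field_simp; norm_num]
            refine mul_le_of_le_one_right (by positivity) ?_
            rw [div_le_one (by positivity)]; linarith
          linarith
  choose l' u' hl'm hu'm hl'1 hu'1 hw hbr using fun q =>
    exists_measurable_bracket (hlo q).1 (hhi q).1
  refine ⟨T.image fun q => (l' q, u' q), ⟨?_, ?_, ?_, ?_, ?_, ?_⟩, ?_⟩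
  · simp only [Finset.mem_image, forall_exists_index, and_imp]
    rintro _ q - rfl; exact hl'm q
  · simp only [Finset.mem_image, forall_exists_index, and_imp]
    rintro _ q - rfl; exact hu'm q
  · simp only [Finset.mem_image, forall_exists_index, and_imp]
    rintro _ q - rfl; exact hl'1 q
  · simp only [Finset.mem_image, forall_exists_index, and_imp]
    rintro _ q - rfl; exact hu'1 q
  · simp only [Finset.mem_image, forall_exists_index, and_imp]
    rintro _ q hq rfl
    refine integral_sq_le_of_eLpNorm_le ?_ (by positivity) ((hw q).trans (hwidth q hq))
    exact (MemLp.of_bound (hu'm q).aestronglyMeasurable 1 (Eventually.of_forall (hu'1 q))).sub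
      (MemLp.of_bound (hl'm q).aestronglyMeasurable 1 (Eventually.of_forall (hl'1 q)))
  · intro f hf
    obtain ⟨g, hg, h, hh, s, hs0, hsL, hfeq⟩ := hF f hf
    obtain ⟨j₁, hj₁⟩ := hcov g hg
    obtain ⟨j₂, hj₂⟩ := hcov h hh
    set i := ⌊s / ρ⌋₊ with hi'
    have hi1 : ρ * i ≤ s := by
      have := Nat.floor_le (a := s / ρ) (by positivity)
      rwa [le_div_iff₀' hρ0] at this
    have hi2 : s ≤ ρ * i + ρ := by
      have := (Nat.lt_floor_add_one (s / ρ)).le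
      rw [div_le_iff₀' hρ0] at this
      linarith
    have hmem : (j₁, j₂, i) ∈ T := by
      simp only [T, Finset.mem_filter, Finset.mem_product, Finset.mem_univ, true_and,
        Finset.mem_range]
      exact ⟨Nat.lt_succ_of_le (Nat.floor_le_floor (by gcongr)), hi1.trans hsL⟩
    refine ⟨_, Finset.mem_image_of_mem _ hmem, hbr _ f (hF1 f hf) fun x => ?_⟩
    have h1 := hj₁ x
    have h2 := hj₂ x
    have h3 := abs_le.1 (hEle h hh x)
    have hi0 : 0 ≤ ρ * i := by positivity
    have hE0 : 0 ≤ E x := (abs_nonneg _).trans (hEle h hh x)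
    have h4 : |(s - ρ * i) * h x| ≤ ρ * E x := by
      rw [abs_mul, abs_of_nonneg (by linarith)]
      exact mul_le_mul (by linarith) (hEle h hh x) (abs_nonneg _) hρ0.le
    have h5 := abs_le.1 h4
    have h6 := mul_le_mul_of_nonneg_left h2.1 hi0
    have h7 := mul_le_mul_of_nonneg_left h2.2 hi0
    rw [hfeq]
    constructor
    · refine mul_le_mul_of_nonneg_left ?_ hc0
      change l j₁ x - (ρ * i) * u j₂ x - ρ * E x ≤ _
      linarith
    · refine mul_le_mul_of_nonneg_left ?_ hc0
      change _ ≤ u j₁ x - (ρ * i) * l j₂ x + ρ * E x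
      linarith
  · have hcardT : (T.card : ℝ) ≤ N * (N * (L / ρ + 1)) := by
      have h1 : T.card ≤ N * (N * (⌊L / ρ⌋₊ + 1)) := by
        refine (Finset.card_filter_le _ _).trans (le_of_eq ?_)
        simp [Finset.card_product]
      have h2 := Nat.floor_le (a := L / ρ) (by positivity)
      calc (T.card : ℝ) ≤ N * (N * (⌊L / ρ⌋₊ + 1)) := by exact_mod_cast h1
        _ ≤ _ := by gcongr
    have hN' : (N : ℝ) ≤ Real.exp (|C| * D ^ (1 / (k : ℝ)) * y) := by
      refine hN.trans (Real.exp_le_exp.2 ?_)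
      -- Parametrizing widths as `y^(-k)` makes the entropy linear in `y`.
      have h1 : (1 / (D * y ^ k)) ^ (-(1 / (k : ℝ))) = D ^ (1 / (k : ℝ)) * y := by
        rw [one_div (D * y ^ k), Real.inv_rpow (by positivity), Real.rpow_neg (by positivity),
          inv_inv, Real.mul_rpow hD0.le hyk.le, ← Real.rpow_natCast, ← Real.rpow_mul hy0.le,
          mul_one_div_cancel hkR.ne', Real.rpow_one]
      rw [h1, mul_assoc]
      exact mul_le_mul_of_nonneg_right (le_abs_self C) (by positivity)
    -- The grid for `s` is polynomial in `y`, hence absorbed by the exponential.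
    have hgrid : L / ρ + 1 ≤ Real.exp (Real.log A * y + y) := by
      have h1 : L / ρ = 4 * L * (K + 1) * y ^ k := by
        rw [hρ]; field_simp
      have h2 : 1 ≤ y ^ k := one_le_pow₀ hy
      have h3 := Real.pow_div_factorial_le_exp y hy0.le k
      rw [div_le_iff₀' (by positivity)] at h3
      calc L / ρ + 1 ≤ (4 * L * (K + 1) + 1) * y ^ k := by rw [h1]; linarith
        _ ≤ (4 * L * (K + 1) + 1) * (k.factorial * Real.exp y) := by gcongr
        _ = Real.exp (Real.log A) * Real.exp y := by
            rw [Real.exp_log (by linarith), hA]; ring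
        _ ≤ _ := by
            rw [← Real.exp_add]
            refine Real.exp_le_exp.2 ?_
            nlinarith [Real.log_nonneg hA1]
    calc ((T.image fun q => (l' q, u' q)).card : ℝ) ≤ T.card := by
          exact_mod_cast Finset.card_image_le
      _ ≤ N * (N * (L / ρ + 1)) := hcardT
      _ ≤ Real.exp (|C| * D ^ (1 / (k : ℝ)) * y) * (Real.exp (|C| * D ^ (1 / (k : ℝ)) * y)
          * Real.exp (Real.log A * y + y)) := by gcongr
      _ = _ := by rw [← Real.exp_add, ← Real.exp_add]; congr 1; ring

end Entropy

/-! ### The rate of convergence -/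

/-- If `x + y` exceeded the bound it would exceed `s` (this is the role of the `+ 1`), so the
constant term is absorbed into the linear one and `min c 1 * (x + y)² ≤ 4 K s (x + y)`; divide by `x
+ y`. -/
lemma add_le_of_quadratic_le {c K s x y : ℝ} (hc : 0 < c) (hK : 0 ≤ K) (hs : 0 ≤ s)
    (h : c * x ^ 2 + y ^ 2 ≤ K * s ^ 2 + K * (s * (x + y))) :
    x + y ≤ (4 * K / min c 1 + 1) * s := by
  set b := min c 1 with hb
  have hb0 : 0 < b := lt_min hc one_pos
  by_contra! hcon
  have hKb : 0 ≤ 4 * K / b := by positivity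
  have h1 : s ≤ x + y := by nlinarith
  have hpos : 0 < x + y := lt_of_le_of_lt (by positivity) hcon
  have h2 : b * x ^ 2 ≤ c * x ^ 2 := mul_le_mul_of_nonneg_right (min_le_left _ _) (sq_nonneg _)
  have h3 : b * y ^ 2 ≤ 1 * y ^ 2 := mul_le_mul_of_nonneg_right (min_le_right _ _) (sq_nonneg _)
  have h4 : K * s ^ 2 ≤ K * (s * (x + y)) := by
    rw [sq]; gcongr
  have h5 : b * (x + y) ^ 2 ≤ 4 * K * s * (x + y) := by
    have : (x + y) ^ 2 ≤ 2 * (x ^ 2 + y ^ 2) := by nlinarith [sq_nonneg (x - y)]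
    nlinarith
  have h6 : b * (x + y) ≤ 4 * K * s := by
    refine le_of_mul_le_mul_right ?_ hpos
    linarith
  have h7 : x + y ≤ 4 * K / b * s := by
    rw [div_mul_eq_mul_div, le_div_iff₀' hb0]; exact h6
  linarith

lemma abs_log_le_of_mem_Icc {c C t : ℝ} (hc : 0 < c) (h₁ : c ≤ t) (h₂ : t ≤ C) :
    |Real.log t| ≤ 1 + |Real.log c| + |Real.log C| := by
  have h3 := Real.log_le_log hc h₁
  have h4 := Real.log_le_log (hc.trans_le h₁) h₂
  have h5 := neg_abs_le (Real.log c)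
  have h6 := le_abs_self (Real.log C)
  have h7 := abs_nonneg (Real.log c)
  have h8 := abs_nonneg (Real.log C)
  rw [abs_le]
  constructor <;> linarith

section Rate

variable {𝓧 E : Type*} [MeasurableSpace 𝓧] [NormedAddCommGroup E] {a b : ℝ}

lemma roughness_nonneg (k : ℕ) (η : Icc a b → ℝ) : 0 ≤ roughness k η := Real.sqrt_nonneg _

/-- The log-likelihood ratios with respect to `η₀`, normalized by `B (1 + J(η))`. -/
def boundedClass (k : ℕ) (p : E → (Icc a b → ℝ) → 𝓧 → ℝ) (Θn : ℕ → Set E)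
    (Vn : ℕ → Set (Icc a b → ℝ)) (η₀ : Icc a b → ℝ) (B : ℝ) : Set (𝓧 → ℝ) :=
  {f | ∃ n, ∃ θ ∈ Θn n, ∃ η ∈ Vn n,
    f = fun x => (B * (1 + roughness k η))⁻¹ * (loglik p θ η x - loglik p θ η₀ x)}

/-- The deterministic part of the argument: the basic inequality for the penalized maximum
likelihood estimator, combined with a bound on the empirical process. -/
lemma rate_of_isPenalizedMLE {P : Measure 𝓧} {k n : ℕ} {p : E → (Icc a b → ℝ) → 𝓧 → ℝ}
    {θ θ₀ : E} {η η₀ : Icc a b → ℝ} {x : ℕ → 𝓧} {lam r A B c C L M M' d d₀ : ℝ}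
    (hη₀ : η₀ ∈ sobolevClass k a b) (hmle : IsPenalizedMLE k p n x lam θ η) (hlam : 0 < lam)
    (hr0 : 0 ≤ r) (hr : r ≤ M' * lam) (hM' : 0 ≤ M') (hB : 0 < B) (hM : 0 ≤ M) (hc : 0 < c)
    (hC : 0 ≤ C) (hL : 0 ≤ L) (hA : 0 ≤ A) (hd : 0 ≤ d) (hd₀0 : 0 ≤ d₀)
    (hd₀ : d₀ ≤ A * ‖θ - θ₀‖)
    (hcurv : ∫ x, (loglik p θ η x - loglik p θ η₀ x) ∂P ≤ -c * d ^ 2 + C * ‖θ - θ₀‖ ^ 2)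
    (hnorm : ∫ x, (loglik p θ η x - loglik p θ η₀ x) ^ 2 ∂P
      ≤ (L * (‖θ - θ₀‖ + d) + L * (‖θ - θ₀‖ + d₀)) ^ 2)
    (hemp : ∀ ρ : ℝ, 0 ≤ ρ → ∫ x, ((B * (1 + roughness k η))⁻¹ *
        (loglik p θ η x - loglik p θ η₀ x)) ^ 2 ∂P ≤ ρ ^ 2 →
      |empDev P n x (fun x => (B * (1 + roughness k η))⁻¹ *
        (loglik p θ η x - loglik p θ η₀ x))| ≤ M * (r * (r + ρ))) :
    d + lam * roughness k η ≤ (4 * (roughness k η₀ ^ 2 + C + M * M' * (M' * B + L * (2 + A)))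
      / min c 1 + 1) * (lam + ‖θ - θ₀‖) := by
  set J := roughness k η with hJ
  set J₀ := roughness k η₀ with hJ₀
  set τ := ‖θ - θ₀‖ with hτ
  have hJ0 : 0 ≤ J := roughness_nonneg k η
  have hτ0 : 0 ≤ τ := norm_nonneg _
  set D : 𝓧 → ℝ := fun x => loglik p θ η x - loglik p θ η₀ x with hD
  set w := B * (1 + J) with hw
  have hw0 : 0 < w := by positivity
  set σ := L * (τ + d) + L * (τ + d₀) with hσ
  have hσ0 : 0 ≤ σ := by positivity
  have h1 : |empDev P n x D| ≤ M * (r * (r * w + σ)) := by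
    have h2 := hemp (w⁻¹ * σ) (by positivity) (by
      simp_rw [mul_pow]
      rw [integral_const_mul]
      gcongr)
    rw [empDev_const_mul, abs_mul, abs_of_pos (inv_pos.2 hw0), inv_mul_le_iff₀ hw0] at h2
    refine h2.trans (le_of_eq ?_)
    field_simp
  have hbasic : lam ^ 2 * J ^ 2 - lam ^ 2 * J₀ ^ 2 ≤ empDev P n x D + ∫ y, D y ∂P := by
    have h2 := hmle.2 η₀ hη₀
    unfold penLoglik at h2
    have h3 : empDev P n x D + ∫ y, D y ∂P = (∑ i ∈ Finset.range n, loglik p θ η (x i)) / n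
        - (∑ i ∈ Finset.range n, loglik p θ η₀ (x i)) / n := by
      simp only [empDev, hD, Finset.sum_sub_distrib]
      ring
    rw [h3]
    linarith
  set s := lam + τ with hs
  have hs0 : 0 ≤ s := by positivity
  have hlams : lam ≤ s := by linarith
  have hτs : τ ≤ s := by linarith
  set y := lam * J with hy
  have hy0 : 0 ≤ y := by positivity
  have hrw : r * w + σ ≤ (M' * B + L * (2 + A)) * (s + (d + y)) := by
    -- Here `r ≲ λ` lets the penalty control the normalization: `r(1 + J) ≲ λ + λJ`.
    have h2 : r * w ≤ M' * B * (s + (d + y)) := by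
      calc r * w ≤ M' * lam * w := by gcongr
        _ = M' * B * (lam + y) := by rw [hw, hy]; ring
        _ ≤ _ := by gcongr; linarith
    have h3 : σ ≤ L * (2 + A) * (s + (d + y)) := by
      have h4 : τ + d + (τ + d₀) ≤ (2 + A) * (s + (d + y)) := by
        have h5 : d₀ ≤ A * s := hd₀.trans (by gcongr)
        have h6 : 0 ≤ A * (d + y) := by positivity
        nlinarith
      calc σ = L * (τ + d + (τ + d₀)) := by rw [hσ]; ring
        _ ≤ L * ((2 + A) * (s + (d + y))) := by gcongr
        _ = _ := by ring
    linarith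
  set Q := M' * B + L * (2 + A) with hQ
  have hQ0 : 0 ≤ Q := by positivity
  have hdev : |empDev P n x D| ≤ M * M' * Q * (s * (s + (d + y))) := by
    refine h1.trans ?_
    calc M * (r * (r * w + σ)) ≤ M * ((M' * s) * (Q * (s + (d + y)))) := by
          have : r ≤ M' * s := hr.trans (by gcongr)
          gcongr
      _ = _ := by ring
  set K₁ := M * M' * Q with hK₁
  have hK₁0 : 0 ≤ K₁ := by positivity
  refine add_le_of_quadratic_le hc (by positivity) hs0 ?_
  have h2 := le_abs_self (empDev P n x D)
  have h3 : lam ^ 2 * J₀ ^ 2 ≤ J₀ ^ 2 * s ^ 2 := by rw [mul_comm]; gcongr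
  have h4 : C * τ ^ 2 ≤ C * s ^ 2 := by gcongr
  have h5 : y ^ 2 = lam ^ 2 * J ^ 2 := by rw [hy]; ring
  have h6 : 0 ≤ (J₀ ^ 2 + C) * (s * (d + y)) := by positivity
  have h7 : (J₀ ^ 2 + C + K₁) * s ^ 2 + (J₀ ^ 2 + C + K₁) * (s * (d + y))
      = J₀ ^ 2 * s ^ 2 + C * s ^ 2 + (J₀ ^ 2 + C) * (s * (d + y)) + K₁ * (s * (s + (d + y))) := by
    ring
  rw [h7]
  linarith

end Rate

end PenalizedRate

theorem theorem1
    {𝓧 Ω : Type*} [MeasurableSpace 𝓧] [MeasurableSpace Ω]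
    -- the parameter spaces and the model
    {q : ℕ} (k : ℕ) (hk : 1 ≤ k) (a b : ℝ) (hab : a < b)
    (Θ : Set (EuclideanSpace ℝ (Fin q))) (hΘ : IsCompact Θ)
    (ν : Measure 𝓧)
    (p : EuclideanSpace ℝ (Fin q) → (Set.Icc a b → ℝ) → 𝓧 → ℝ)
    (hp : PenalizedRate.IsDensityFamily ν Θ (PenalizedRate.sobolevClass k a b) p)
    (θ₀ : EuclideanSpace ℝ (Fin q)) (hθ₀ : θ₀ ∈ Θ)
    (η₀ : Set.Icc a b → ℝ) (hη₀ : η₀ ∈ PenalizedRate.sobolevClass k a b)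
    (P : Measure 𝓧) (hP : P = PenalizedRate.densityLaw ν (p θ₀ η₀))
    -- independent observations with distribution `P`
    (μ : Measure Ω) [IsProbabilityMeasure μ]
    (X : ℕ → Ω → 𝓧) (hX : ∀ i, Measurable (X i)) (hindep : iIndepFun X μ)
    (hlaw : ∀ i, Measure.map (X i) μ = P)
    -- the smoothing parameter, possibly depending on the data
    (lam : ℕ → Ω → ℝ) (hlam_pos : ∀ n ω, 0 < lam n ω)
    (hlam_upper : PenalizedRate.IsLittleOP μ lam (fun n _ => (n : ℝ) ^ (-(1 / 4) : ℝ)))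
    (hlam_lower : PenalizedRate.IsBigOP μ (fun n ω => (lam n ω)⁻¹)
      (fun n _ => (n : ℝ) ^ ((k : ℝ) / (2 * k + 1))))
    -- the sets `Θₙ`, `𝓥ₙ` and the distances `d_θ`
    (C₁ : ℝ) (hC₁ : 0 < C₁)
    (Θn : ℕ → Set (EuclideanSpace ℝ (Fin q)))
    (hΘn : ∀ n, ∀ θ ∈ Θn n, θ ∈ Θ ∧ ‖θ - θ₀‖ ≤ C₁)
    (Vn : ℕ → Set (Set.Icc a b → ℝ))
    (hVn : ∀ n, ∀ η ∈ Vn n, η ∈ PenalizedRate.sobolevClass k a b ∧ ∀ z, |η z - η₀ z| ≤ C₁)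
    (hη₀Vn : ∀ n, η₀ ∈ Vn n)
    (d : EuclideanSpace ℝ (Fin q) → (Set.Icc a b → ℝ) → (Set.Icc a b → ℝ) → ℝ)
    (hd : ∀ θ η η', 0 ≤ d θ η η')
    -- the entropy condition
    (hentropy : ∃ C : ℝ, ∀ ε : ℝ, 0 < ε →
      PenalizedRate.bracketingEntropy P (PenalizedRate.normalizedClass k p Θ θ₀ η₀ C₁) ε
        ≤ ((C * ε ^ (-(1 / (k : ℝ))) : ℝ) : EReal))
    -- the density ratio is bounded away from zero and infinity
    (hratio : ∃ c C : ℝ, 0 < c ∧ ∀ n, ∀ θ ∈ Θn n, ∀ η ∈ Vn n, ∀ x,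
      c ≤ p θ η x / p θ η₀ x ∧ p θ η x / p θ η₀ x ≤ C)
    -- the `L₂` Lipschitz bound
    (hlip : ∃ C : ℝ, ∀ n, ∀ θ ∈ Θn n, ∀ η ∈ Vn n,
      eLpNorm (fun x => PenalizedRate.loglik p θ η x - PenalizedRate.loglik p θ₀ η₀ x) 2 P
        ≤ ENNReal.ofReal (C * (‖θ - θ₀‖ + d θ η η₀)))
    -- the quadratic curvature bound
    (hcurv : ∃ c C : ℝ, 0 < c ∧ ∀ n, ∀ θ ∈ Θn n, ∀ η ∈ Vn n,
      ∫ x, (PenalizedRate.loglik p θ η x - PenalizedRate.loglik p θ η₀ x) ∂P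
        ≤ -c * d θ η η₀ ^ 2 + C * ‖θ - θ₀‖ ^ 2)
    -- the estimators
    (θt : ℕ → Ω → EuclideanSpace ℝ (Fin q)) (ηhat : ℕ → Ω → (Set.Icc a b → ℝ))
    (hmle : PenalizedRate.WithProbTendstoOne μ (fun n => {ω |
      PenalizedRate.IsPenalizedMLE k p n (fun i => X i ω) (lam n ω) (θt n ω) (ηhat n ω)}))
    (hmem : PenalizedRate.WithProbTendstoOne μ (fun n => {ω |
      θt n ω ∈ Θn n ∧ ηhat n ω ∈ Vn n})) :
    PenalizedRate.IsBigOP μ (fun n ω => d (θt n ω) (ηhat n ω) η₀)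
        (fun n ω => lam n ω + ‖θt n ω - θ₀‖) ∧
      PenalizedRate.IsBigOP μ (fun n ω => lam n ω * PenalizedRate.roughness k (ηhat n ω))
        (fun n ω => lam n ω + ‖θt n ω - θ₀‖) := by
  have hPprob : IsProbabilityMeasure P := by
    rw [← hlaw 0]
    exact Measure.isProbabilityMeasure_map (hX 0).aemeasurable
  obtain ⟨c₁, C₂, hc₁, hratio⟩ := hratio
  obtain ⟨C₃, hlip⟩ := hlip
  obtain ⟨c, C₄, hc, hcurv⟩ := hcurv
  -- The summand 1 ensures `B⁻¹ ≤ 1`, the factor allowed in `exists_isBracketCover_of_entropy`.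
  set B := 1 + |Real.log c₁| + |Real.log C₂| with hB
  have hB1 : 1 ≤ B := by
    have := abs_nonneg (Real.log c₁)
    have := abs_nonneg (Real.log C₂)
    linarith
  have hmeas : ∀ n, ∀ θ ∈ Θn n, ∀ η ∈ Vn n, Measurable (PenalizedRate.loglik p θ η) :=
    fun n θ hθ η hη =>
      Real.measurable_log.comp (hp.measurable θ (hΘn n θ hθ).1 η (hVn n η hη).1)
  have hbound : ∀ n, ∀ θ ∈ Θn n, ∀ η ∈ Vn n, ∀ x,
      |PenalizedRate.loglik p θ η x - PenalizedRate.loglik p θ η₀ x| ≤ B := by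
    intro n θ hθ η hη x
    have h1 := hp.pos θ (hΘn n θ hθ).1 η (hVn n η hη).1 x
    have h2 := hp.pos θ (hΘn n θ hθ).1 η₀ hη₀ x
    unfold PenalizedRate.loglik
    rw [← Real.log_div h1.ne' h2.ne']
    exact PenalizedRate.abs_log_le_of_mem_Icc hc₁ (hratio n θ hθ η hη x).1
      (hratio n θ hθ η hη x).2
  let F := PenalizedRate.boundedClass k p Θn Vn η₀ B
  have hFm : ∀ f ∈ F, Measurable f := by
    rintro f ⟨n, θ, hθ, η, hη, rfl⟩
    exact ((hmeas n θ hθ η hη).sub (hmeas n θ hθ η₀ (hη₀Vn n))).const_mul _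
  have hF1 : ∀ f ∈ F, ∀ x, |f x| ≤ 1 := by
    rintro f ⟨n, θ, hθ, η, hη, rfl⟩ x
    have h1 := PenalizedRate.roughness_nonneg k η
    rw [abs_mul, abs_of_pos (by positivity), inv_mul_le_iff₀ (by positivity), mul_one]
    refine (hbound n θ hθ η hη x).trans ?_
    nlinarith
  -- The entropy condition concerns ratios centred at `ℓ₀`, the empirical bound those centred at
  -- `ℓ_{θ,η₀}`. The latter are `B⁻¹(g - s h)` with `g`, `h` the normalized ratios at `(θ, η)`, `(θ,
  -- η₀)` and `s = (1 + J₀)/(1 + J) ≤ 1 + J₀`.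
  obtain ⟨C₅, hC₅, hcov⟩ := PenalizedRate.exists_isBracketCover_of_entropy (P := P) (F := F)
    (c := B⁻¹) (L := 1 + PenalizedRate.roughness k η₀) hk (by positivity)
    (inv_le_one_of_one_le₀ hB1) (by have := PenalizedRate.roughness_nonneg k η₀; positivity)
    hentropy hF1 (by
      rintro f ⟨n, θ, hθ, η, hη, rfl⟩
      have h1 := PenalizedRate.roughness_nonneg k η
      have h2 := PenalizedRate.roughness_nonneg k η₀
      refine ⟨_, ⟨θ, (hΘn n θ hθ).1, η, (hVn n η hη).1, (hΘn n θ hθ).2, (hVn n η hη).2, rfl⟩,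
        _, ⟨θ, (hΘn n θ hθ).1, η₀, hη₀, (hΘn n θ hθ).2, fun z => by simpa using hC₁.le, rfl⟩,
        (1 + PenalizedRate.roughness k η₀) / (1 + PenalizedRate.roughness k η), by positivity,
        div_le_self (by positivity) (by linarith), ?_⟩
      funext x
      field_simp
      ring)
  -- Both summands are nonnegative, so one bound on their sum yields both claims. The exceptional
  -- set is a union of four sets of outer measure at most `ε / 4`.
  have key : ∀ ε : ℝ, 0 < ε → ∃ K : ℝ, ∀ᶠ n in atTop, ∃ N : Set Ω, μ N ≤ ENNReal.ofReal ε ∧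
      ∀ ω, ω ∉ N → d (θt n ω) (ηhat n ω) η₀ + lam n ω * PenalizedRate.roughness k (ηhat n ω)
        ≤ K * (lam n ω + ‖θt n ω - θ₀‖) := by
    intro ε hε
    have hε4 : 0 < ε / 4 := by positivity
    obtain ⟨M₀, hM₀⟩ := hlam_lower (ε / 4) hε4
    set M' := max M₀ 0 with hM'
    -- Chosen so that `16 k! exp (-t) ≤ 16 k! / t = ε / 4`; `M` below then makes the exponent `M/24
    -- - 4C₅ - 1` equal to `t`.
    set t := 64 * k.factorial / ε with ht
    have ht0 : 0 < t := by positivity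
    set M := 24 * (4 * C₅ + 1 + t) with hM
    have hMκ : M / 24 - 4 * C₅ = 1 + t := by rw [hM]; ring
    have hM1 : 1 ≤ M := by rw [hM]; linarith
    set A := |C₄| / c + 1 with hA
    have hA1 : 1 ≤ A := by
      have : 0 ≤ |C₄| / c := by positivity
      linarith
    refine ⟨4 * (PenalizedRate.roughness k η₀ ^ 2 + |C₄|
      + 28 * M * M' * (M' * B + |C₃| * (2 + A))) / min c 1 + 1, ?_⟩
    filter_upwards [hM₀, ENNReal.tendsto_nhds_zero.1 hmle _ (ENNReal.ofReal_pos.2 hε4),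
      ENNReal.tendsto_nhds_zero.1 hmem _ (ENNReal.ofReal_pos.2 hε4), eventually_gt_atTop 0]
      with n h1 h2 h3 hn
    have hn1 : (1 : ℝ) ≤ n := by exact_mod_cast hn
    -- With this `v`, the rate `r = v^(-k)` is `n^(-k/(2k+1))`, the order of the lower bound on `λ`.
    set v : ℝ := (n : ℝ) ^ (1 / (2 * k + 1) : ℝ) with hv
    have hv1 : 1 ≤ v := Real.one_le_rpow hn1 (by positivity)
    have hvn : v ^ (2 * k + 1) = n := by
      rw [hv, ← Real.rpow_natCast, ← Real.rpow_mul (by positivity)]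
      push_cast
      rw [one_div_mul_cancel (by positivity), Real.rpow_one]
    have hvk : (n : ℝ) ^ ((k : ℝ) / (2 * k + 1)) = v ^ k := by
      rw [hv, ← Real.rpow_natCast, ← Real.rpow_mul (by positivity)]
      congr 1
      ring
    have h4 := PenalizedRate.measure_exists_lt_abs_empDev_le_of_entropy hX hindep hlaw hk hn hv1
      hvn hM1 (by rw [hMκ]; linarith) hC₅ hcov hFm hF1
    set N₄ := {ω | ∃ f ∈ F, ∃ ρ : ℝ, 0 ≤ ρ ∧ ∫ x, f x ^ 2 ∂P ≤ ρ ^ 2 ∧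
        28 * M * (1 / v ^ k * (1 / v ^ k + ρ)) < |PenalizedRate.empDev P n (fun i => X i ω) f|}
      with hN₄
    have h5 : μ N₄ ≤ ENNReal.ofReal (ε / 4) := by
      refine h4.trans (ENNReal.ofReal_le_ofReal ?_)
      rw [hMκ, add_sub_cancel_left, Real.exp_neg]
      have h6 : t ≤ Real.exp t := by linarith [Real.add_one_le_exp t]
      calc 16 * (k.factorial : ℝ) * (Real.exp t)⁻¹ ≤ 16 * k.factorial * t⁻¹ := by gcongr
        _ = ε / 4 := by rw [ht]; field_simp; norm_num
    refine ⟨_ ∪ (_ ∪ (_ ∪ N₄)), (measure_union_le _ _).trans ((add_le_add h1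
      ((measure_union_le _ _).trans (add_le_add h2 ((measure_union_le _ _).trans
        (add_le_add h3 h5))))).trans (le_of_eq ?_)), fun ω hω => ?_⟩
    · rw [← ENNReal.ofReal_add hε4.le hε4.le, ← ENNReal.ofReal_add hε4.le (by positivity),
        ← ENNReal.ofReal_add hε4.le (by positivity)]
      congr 1; ring
    · simp only [mem_union, not_or, notMem_compl_iff] at hω
      obtain ⟨hω1, hω2, ⟨hθ, hη⟩, hω4⟩ := hω
      simp only [mem_ofPred_eq, not_lt, hvk] at hω1 hω2
      have hlam := hlam_pos n ω
      have hvk0 : 0 < v ^ k := by positivity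
      rw [abs_of_pos (inv_pos.2 hlam), abs_of_pos hvk0] at hω1
      set θ := θt n ω
      set η := ηhat n ω
      have hη₀n := hη₀Vn n
      have hm := hmeas n θ hθ η hη
      have hm₀ := hmeas n θ hθ η₀ hη₀n
      have hτ0 : 0 ≤ ‖θ - θ₀‖ := norm_nonneg _
      have hD : MemLp (fun x => PenalizedRate.loglik p θ η x - PenalizedRate.loglik p θ η₀ x) 2 P :=
        MemLp.of_bound (hm.sub hm₀).aestronglyMeasurable B
          (Eventually.of_forall (hbound n θ hθ η hη))
      refine PenalizedRate.rate_of_isPenalizedMLE (P := P) (r := 1 / v ^ k)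
        (d₀ := d θ η₀ η₀) hη₀ hω2 hlam (by positivity) ?_ (le_max_right _ _) (by positivity)
        (by positivity) hc (abs_nonneg C₄) (abs_nonneg C₃) (by positivity) (hd _ _ _) (hd _ _ _)
        ?_ ?_ ?_ ?_
      · have h6 : (lam n ω)⁻¹ ≤ M' * v ^ k :=
          hω1.trans (mul_le_mul_of_nonneg_right (le_max_left _ _) hvk0.le)
        rw [inv_le_iff_one_le_mul₀ hlam] at h6
        rw [div_le_iff₀ hvk0]
        linarith
      -- No axiom gives `d θ η₀ η₀ = 0`. The curvature condition at `η = η₀` has left side zero and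
      -- yields `c d₀² ≤ C₄ τ²`; since `A ≥ 1` dominates `|C₄| / c`, so does `A²`.
      · have h6 := hcurv n θ hθ η₀ hη₀n
        simp only [sub_self, integral_zero] at h6
        have h7 := mul_le_mul_of_nonneg_right (le_abs_self C₄) (sq_nonneg ‖θ - θ₀‖)
        have h8 : d θ η₀ η₀ ^ 2 ≤ |C₄| / c * ‖θ - θ₀‖ ^ 2 := by
          rw [div_mul_eq_mul_div, le_div_iff₀' hc]
          linarith
        refine (sq_le_sq₀ (hd _ _ _) (by positivity)).1 (h8.trans ?_)
        rw [mul_pow]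
        gcongr
        have h9 : 0 ≤ |C₄| / c := by positivity
        rw [hA]
        nlinarith
      · refine (hcurv n θ hθ η hη).trans ?_
        gcongr
        exact le_abs_self C₄
      · have hd1 := hd θ η η₀
        have hd2 := hd θ η₀ η₀
        refine PenalizedRate.integral_sq_le_of_eLpNorm_le hD (by positivity) ?_
        set ℓ₀ := PenalizedRate.loglik p θ₀ η₀
        have h6 : (fun x => PenalizedRate.loglik p θ η x - PenalizedRate.loglik p θ η₀ x)
            = (fun x => PenalizedRate.loglik p θ η x - ℓ₀ x)
              - (fun x => PenalizedRate.loglik p θ η₀ x - ℓ₀ x) := by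
          funext x
          simp
        have hm₁ : Measurable ℓ₀ := Real.measurable_log.comp (hp.measurable θ₀ hθ₀ η₀ hη₀)
        have hle : ∀ z : ℝ, 0 ≤ z → ENNReal.ofReal (C₃ * z) ≤ ENNReal.ofReal (|C₃| * z) :=
          fun z hz => ENNReal.ofReal_le_ofReal
            (mul_le_mul_of_nonneg_right (le_abs_self C₃) hz)
        rw [h6, ENNReal.ofReal_add (by positivity) (by positivity)]
        exact (eLpNorm_sub_le (hm.sub hm₁).aestronglyMeasurable
          (hm₀.sub hm₁).aestronglyMeasurable (by norm_num)).trans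
          (add_le_add ((hlip n θ hθ η hη).trans (hle _ (by positivity)))
            ((hlip n θ hθ η₀ hη₀n).trans (hle _ (by positivity))))
      · intro ρ hρ0 hρ
        by_contra! hcon
        exact hω4 ⟨_, ⟨n, θ, hθ, η, hη, rfl⟩, ρ, hρ0, hρ, hcon⟩
  have hd0 := fun n ω => hd (θt n ω) (ηhat n ω) η₀
  have hJ0 := fun n ω =>
    mul_nonneg (hlam_pos n ω).le (PenalizedRate.roughness_nonneg k (ηhat n ω))
  have hs0 := fun n ω => add_nonneg (hlam_pos n ω).le (norm_nonneg (θt n ω - θ₀))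
  constructor <;> intro ε hε <;> obtain ⟨K, hK⟩ := key ε hε <;> refine ⟨K, ?_⟩ <;>
    filter_upwards [hK] with n ⟨N, hN, hKN⟩ <;>
    refine (measure_mono fun ω hω => ?_).trans hN <;> by_contra hωN <;>
    have h1 := hKN ω hωN <;> have h2 := hd0 n ω <;> have h3 := hJ0 n ω
  · simp only [mem_ofPred_eq, abs_of_nonneg (hs0 n ω), abs_of_nonneg h2] at hω
    linarith
  · simp only [mem_ofPred_eq, abs_of_nonneg (hs0 n ω), abs_of_nonneg h3] at hω
    linarith
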